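/- Let $0<q<1$ and $n\ge 0$. Let $\varphi_k(x)=\left(\frac{1}{\sqrt{2\pi}\,k!}\right)^{1/2}H_k(x)e^{-x^2/4}$, $k=0,1,2,\dots$, where $H_k$ is the monic Hermite polynomial of degree $k$ (orthogonal with respect to $e^{-x^2/2}dx$). For integers $0\le k_1<\dots<k_n$ put $\Phi_{k_1,\dots,k_n}(x_1,\dots,x_n)=\frac{1}{\sqrt{n!}}\det(\varphi_{k_i}(x_j))_{i,j=1}^n$, and let $$P_n(x_1,\dots,x_n)=\frac{1}{Z_n(q)}\sum_{0\le k_1<\dots<k_n}|\Phi_{k_1,\dots,k_n}(x_1,\dots,x_n)|^2\,q^{k_1+\dots+k_n+n/2},\qquad Z_n(q)=\sum_{0\le k_1<\dots<k_n}q^{k_1+\dots+k_n+n/2},$$ be the density of the $n$-particle canonical MNS model, and $\mathbb P_n$ the probability measure on $\mathbb R^n$ with density $P_n$. Let $$F(z)=q^{-n(n-1)/2}(q;q)_n\frac{(-z;q)_\infty}{z^n},\qquad (a;q)_n=\prod_{k=0}^{n-1}(1-aq^k),\quad (a;q)_\infty=\prod_{k=0}^{\infty}(1-aq^k),$$ and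 for $z\in\mathbb C\setminus\{-q^{-k}:k\ge 0\}$ let $\mathbf K(z;q)$ be the integral operator on $L^2(\mathbb R)$ with kernel $$K(x,y;z;q)=\sum_{k=0}^\infty\frac{q^kz}{1+q^kz}\varphi_k(x)\varphi_k(y).$$ For measurable $B\subseteq\mathbb R$ let $\chi_B$ be the projection of $L^2(\mathbb R)$ onto $L^2(B)$. Below, $\oint_0$ denotes integration over any positively oriented circle $|z|=r$, $r>0$, that contains none of the points $-q^{-k}$, $k\ge 0$. (a) For every measurable $A\subseteq\mathbb R$ and every $z\notin\{-q^{-k}\}$, $\mathbf K(z;q)$ is a bounded integral operator on $L^2(\mathbb R)$, $\mathbf K(z;q)\chi_{A^c}$ is of trace class, so that the Fredholm determinant $\det(I-\mathbf K(z;q)\chi_{A^c})$ is well defined, the integrand below is integrable on the circle, and $$\mathbb P_n(x_1,\dots,x_n\in A)=\frac{1}{2\pi i}\oint_0F(z)\det(I-\mathbf K(z;q)\chi_{A^c})\frac{dz}{z}.$$ (b) For $m\ge 0$ and $x_1,\dots,x_m\in\mathbb R$ let $$I=\frac{1}{2\pi i}\oint_0F(z)\det\bigl(K(x_i,x_j;z;q)\bigr)_{i,j=1}^m\frac{dz}{z},$$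 where the integrand is integrable on the circle. The $m$-point correlation function $R_n^{(m)}(x_1,\dots,x_m)$ equals $I$, in both of its definitions: if $m\le n$, then $$\frac{n!}{(n-m)!}\int_{\mathbb R^{n-m}}P_n(x_1,\dots,x_n)\,dx_{m+1}\cdots dx_n=I,$$ and if $x_1,\dots,x_m$ are pairwise distinct, then $$\lim_{\Delta\to0^+}\frac{1}{\Delta^m}\,\mathbb P_n\bigl(\text{there is at least one particle in each }[x_i,x_i+\Delta),\ i=1,\dots,m\bigr)=I.$$ -/

import Mathlib

open MeasureTheory Filter Topology

noncomputable section

namespace MNS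

/-- The Hermite function `φ_k(x) = (1 / (√(2π) k!))^{1/2} H_k(x) e^{-x²/4}`, where `H_k` is the
monic (probabilists') Hermite polynomial of degree `k`. -/
def phi (k : ℕ) (x : ℝ) : ℝ :=
  Real.sqrt (1 / (Real.sqrt (2 * Real.pi) * (k.factorial : ℝ))) *
    Polynomial.aeval x (Polynomial.hermite k) * Real.exp (-x ^ 2 / 4)

/-- The `n`-tuples of integers `0 ≤ k_1 < k_2 < ... < k_n`. -/
abbrev State (n : ℕ) : Type := {k : Fin n → ℕ // StrictMono k}

/-- The Slater determinant `Φ_{k_1, ..., k_n}(x_1, ..., x_n)`. -/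
def slater (n : ℕ) (k : Fin n → ℕ) (x : Fin n → ℝ) : ℝ :=
  1 / Real.sqrt (n.factorial : ℝ) * (Matrix.of fun i j : Fin n => phi (k i) (x j)).det

/-- The Boltzmann weight `q^{k_1 + ... + k_n + n/2}`. -/
def weight (n : ℕ) (q : ℝ) (k : Fin n → ℕ) : ℝ :=
  q ^ ((∑ i, (k i : ℝ)) + (n : ℝ) / 2)

/-- The partition function `Z_n(q)`. -/
def partitionFunction (n : ℕ) (q : ℝ) : ℝ :=
  ∑' k : State n, weight n q k.1

/-- The density `P_n` of the `n`-particle canonical MNS model. -/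
def density (n : ℕ) (q : ℝ) (x : Fin n → ℝ) : ℝ :=
  1 / partitionFunction n q * ∑' k : State n, |slater n k.1 x| ^ 2 * weight n q k.1

/-- The law `ℙ_n` on `ℝⁿ` with density `P_n` with respect to the Lebesgue measure. -/
def law (n : ℕ) (q : ℝ) : Measure (Fin n → ℝ) :=
  volume.withDensity fun x => ENNReal.ofReal (density n q x)

/-- The `m`-point correlation function as an integrated density,
`R_n^{(m)}(x_1, ..., x_m) = n! / (n-m)! ∫_{ℝ^{n-m}} P_n(x_1, ..., x_m, y_1, ..., y_{n-m}) dy`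
(for `m ≤ n`). -/
def correlation (n m : ℕ) (q : ℝ) (x : Fin m → ℝ) : ℝ :=
  (n.factorial : ℝ) / ((n - m).factorial : ℝ) *
    ∫ y : Fin (n - m) → ℝ, density n q fun i : Fin n =>
      if h : (i : ℕ) < m then x ⟨i, h⟩ else y ⟨i - m, by omega⟩

/-- The finite `q`-Pochhammer symbol `(a; q)_n = ∏_{k=0}^{n-1} (1 - a q^k)`. -/
def qPoch (a q : ℂ) (n : ℕ) : ℂ := ∏ k ∈ Finset.range n, (1 - a * q ^ k)

/-- The infinite `q`-Pochhammer symbol `(a; q)_∞ = ∏_{k=0}^∞ (1 - a q^k)`. -/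
def qPochInf (a q : ℂ) : ℂ := ∏' k : ℕ, (1 - a * q ^ k)

/-- `F(z) = q^{-n(n-1)/2} (q; q)_n (-z; q)_∞ / z^n`. -/
def F (n : ℕ) (q : ℝ) (z : ℂ) : ℂ :=
  ((q ^ (-((n : ℝ) * ((n : ℝ) - 1) / 2)) : ℝ) : ℂ) * qPoch q q n * (qPochInf (-z) q / z ^ n)

/-- The kernel `K(x, y; z; q) = ∑_k q^k z / (1 + q^k z) φ_k(x) φ_k(y)`. -/
def kernel (q : ℝ) (z : ℂ) (x y : ℝ) : ℂ :=
  ∑' k : ℕ, (q : ℂ) ^ k * z / (1 + (q : ℂ) ^ k * z) * (phi k x : ℂ) * (phi k y : ℂ)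

/-- The complex Hilbert space `L²(ℝ)`. -/
abbrev L2R : Type := Lp ℂ 2 (volume : Measure ℝ)

/-- `T` is the integral operator on `L²(ℝ)` with kernel `k`. -/
def IsIntegralOperator (k : ℝ → ℝ → ℂ) (T : L2R →L[ℂ] L2R) : Prop :=
  ∀ f : L2R, ∀ᵐ x : ℝ, Integrable (fun y : ℝ => k x y * f y) ∧ T f x = ∫ y : ℝ, k x y * f y

open Classical in
/-- The bounded integral operator on `L²(ℝ)` with kernel `k` (it is unique if it exists;
`0` if there is none). -/
def integralOperator (k : ℝ → ℝ → ℂ) : L2R →L[ℂ] L2R :=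
  if h : ∃ T, IsIntegralOperator k T then h.choose else 0

/-- The projection `χ_B` of `L²(ℝ)` onto `L²(B)`: multiplication by the indicator function. -/
def chi (B : Set ℝ) (hB : MeasurableSet B) : L2R →L[ℂ] L2R :=
  LinearMap.mkContinuous
    { toFun := fun f => ((Lp.memLp f).indicator hB).toLp (B.indicator f)
      map_add' := fun f g => by
        rw [← MemLp.toLp_add]
        apply MemLp.toLp_congr
        filter_upwards [Lp.coeFn_add f g] with x hx
        by_cases h : x ∈ B
        · simpa [h] using hx
        · simp [h]
      map_smul' := fun c f => by
        rw [RingHom.id_apply, ← MemLp.toLp_const_smul]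
        apply MemLp.toLp_congr
        filter_upwards [Lp.coeFn_smul c f] with x hx
        by_cases h : x ∈ B
        · simpa [h] using hx
        · simp [h] }
    1 fun f => by
      rw [one_mul]
      apply Lp.norm_le_norm_of_ae_le
      filter_upwards [((Lp.memLp f).indicator hB).coeFn_toLp] with x hx
      simp only [LinearMap.coe_mk, AddHom.coe_mk]
      rw [hx]
      exact norm_indicator_le_norm_self _ _

section Fredholm

variable {H : Type*} [NormedAddCommGroup H] [InnerProductSpace ℂ H]

/-- Trace class operators on a Hilbert space: `T = ∑_k ⟨u_k, ·⟩ v_k` with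
`∑_k ‖u_k‖ ‖v_k‖ < ∞`. -/
def IsTraceClass (T : H →L[ℂ] H) : Prop :=
  ∃ u v : ℕ → H, Summable (fun k => ‖u k‖ * ‖v k‖) ∧
    ∀ f : H, HasSum (fun k => inner ℂ (u k) f • v k) (T f)

/-- The determinant of the compression `P_V B|_V` of `B` to a finite-dimensional subspace `V`. -/
def compressionDet (B : H →L[ℂ] H) (V : {V : Submodule ℂ H // V.FG}) : ℂ :=
  haveI : FiniteDimensional ℂ V.1 := Module.Finite.iff_fg.2 V.2
  LinearMap.det
    ((V.1.orthogonalProjectionOnto ∘L B ∘L V.1.subtypeL : V.1 →L[ℂ] V.1) : V.1 →ₗ[ℂ] V.1)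

/-- `B = I + T` with `T` of trace class has Fredholm determinant `d`: the determinants of the
compressions of `B` to the finite-dimensional subspaces, directed by inclusion, converge to `d`. -/
def HasFredholmDet (B : H →L[ℂ] H) (d : ℂ) : Prop :=
  IsTraceClass (B - ContinuousLinearMap.id ℂ H) ∧ Tendsto (compressionDet B) atTop (𝓝 d)

/-- The Fredholm determinant `det B` of `B = I + T` with `T` of trace class. -/
def fredholmDet (B : H →L[ℂ] H) : ℂ := limUnder atTop (compressionDet B)

end Fredholm

/-- The integral operator `𝐊(z; q)` on `L²(ℝ)` with kernel `K(x, y; z; q)`. -/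
def opK (q : ℝ) (z : ℂ) : L2R →L[ℂ] L2R := integralOperator (kernel q z)

/-- The operator `I - 𝐊(z; q) χ_B` on `L²(ℝ)`. -/
def oneSubK (q : ℝ) (z : ℂ) (B : Set ℝ) (hB : MeasurableSet B) : L2R →L[ℂ] L2R :=
  ContinuousLinearMap.id ℂ L2R - opK q z ∘L chi B hB

end MNS

end

/-! The model is a mixture: squared Slater determinants are averaged over the finite sets `S` of
occupied levels with `S.card = n`, with weight proportional to `∏_{i ∈ S} q ^ i`. For fixed `S` both
observables are determinants. The probability of lying in `A` is a principal minor of the matrix of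
the integrals of `φ_j φ_k` over `A`, and the `m`-point function is the determinant of `∑_{k ∈ S}
φ_k(x_i) φ_k(x_j)`. Both follow by expanding the square over pairs of permutations (`permSum`) and
integrating one variable at a time (`integral_slater_sq_pi_const`, `integral_slater_sq_append`).

The constraint on the number of particles is traded for a contour integral. The average of `c` is,
up to normalization, the coefficient of `z ^ n` in `∑_S (∏_{i ∈ S} q ^ i z) c(S)`. The normalization
is the elementary symmetric function of `1, q, q², …`, computed in `elemSymm_mul_prod`; this
produces the prefactor of `F`.

The unconstrained sum is `(-z; q)_∞` times a determinant. With `w_i = q ^ i z`, multiplying row `i`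
of `I - (w_i / (1 + w_i)) N` by `1 + w_i` gives row `i` of `I + w_i (I - N)`, and both determinants
expand into principal minors (`prod_one_add_mul_sum_principalMinor`). Taking for `N` the overlaps on
the complement of `A` gives the gap formula; taking a matrix of rank at most `m` and using `det (1 +
AB) = det (1 + BA)` gives the correlation formula (`prod_one_add_mul_det_gram`). The sums over `S`
converge for every `z`, so the radius need not be small.

Two estimates justify the infinite sums: on bounded sets `φ_k` grows more slowly than any geometric
sequence (`abs_phi_le_phiBound`), and minors are bounded by products over `S`
(`norm_principalMinor_le`). The latter also gives the Fredholm determinant, by dominated convergence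
over subspaces (`compressionDet_tendsto`). The limit of probabilities comes from summing over which
particle sits in which interval; coincidences cost an extra factor `Δ` (`tendsto_law_occupied`). -/

noncomputable section

namespace MNS

/-! ### Hermite functions: orthonormality and growth in the index -/

section Hermite

open Polynomial

/-- The Hermite polynomials with real coefficients. -/
def hermiteR (k : ℕ) : ℝ[X] := (hermite k).map (Int.castRingHom ℝ)

lemma aeval_hermite (k : ℕ) (x : ℝ) : aeval x (hermite k) = (hermiteR k).eval x := by
  simp [hermiteR, aeval_def, eval_map]

lemma hermiteR_zero : hermiteR 0 = 1 := by simp [hermiteR]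

lemma hermiteR_succ (k : ℕ) :
    hermiteR (k + 1) = X * hermiteR k - derivative (hermiteR k) := by
  simp [hermiteR, hermite_succ, derivative_map]

lemma derivative_hermiteR_succ (k : ℕ) :
    derivative (hermiteR (k + 1)) = C ((k : ℝ) + 1) * hermiteR k := by
  induction k with
  | zero => simp [hermiteR_succ, hermiteR_zero]
  | succ k ih =>
    rw [hermiteR_succ (k + 1)]
    simp only [derivative_sub, derivative_mul, derivative_X, ih, derivative_C]
    rw [hermiteR_succ k]
    push_cast
    simp only [map_add, map_one]
    ring

lemma hermiteR_add_two (k : ℕ) :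
    hermiteR (k + 2) = X * hermiteR (k + 1) - C ((k : ℝ) + 1) * hermiteR k := by
  rw [hermiteR_succ (k + 1), derivative_hermiteR_succ]

lemma integrable_pow_mul_gaussian (m : ℕ) :
    Integrable fun x : ℝ => x ^ m * Real.exp (-x ^ 2 / 2) := by
  have h := integrable_rpow_mul_exp_neg_mul_sq (b := 1 / 2) (by norm_num)
    (s := m) (lt_of_lt_of_le (by norm_num) (Nat.cast_nonneg m))
  refine h.congr (Eventually.of_forall fun x => ?_)
  simp only [Real.rpow_natCast]
  congr 2
  ring

lemma integrable_eval_mul_gaussian (p : ℝ[X]) :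
    Integrable fun x : ℝ => p.eval x * Real.exp (-x ^ 2 / 2) := by
  induction p using Polynomial.induction_on' with
  | add p r hp hr =>
    refine (hp.add hr).congr (Eventually.of_forall fun x => ?_)
    simp [add_mul]
  | monomial m a =>
    refine ((integrable_pow_mul_gaussian m).const_mul a).congr (Eventually.of_forall fun x => ?_)
    simp [mul_assoc]

/-- Integration by parts: the difference of the integrands is the derivative of `p` times the
Gaussian, which is integrable together with its derivative. -/
lemma integral_derivative_gaussian (p : ℝ[X]) :
    ∫ x : ℝ, (X * p).eval x * Real.exp (-x ^ 2 / 2) =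
      ∫ x : ℝ, (derivative p).eval x * Real.exp (-x ^ 2 / 2) := by
  have h : ∫ x : ℝ, ((derivative p).eval x * Real.exp (-x ^ 2 / 2) -
      (X * p).eval x * Real.exp (-x ^ 2 / 2)) = 0 := by
    refine integral_eq_zero_of_hasDerivAt_of_integrable
      (f := fun x : ℝ => p.eval x * Real.exp (-x ^ 2 / 2)) (fun x => ?_)
      ((integrable_eval_mul_gaussian _).sub (integrable_eval_mul_gaussian _))
      (integrable_eval_mul_gaussian p)
    have h2 : HasDerivAt (fun x : ℝ => -x ^ 2 / 2) (-x) x :=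
      (((hasDerivAt_pow 2 x).neg).div_const 2).congr_deriv (by push_cast; ring)
    refine ((p.hasDerivAt x).mul h2.exp).congr_deriv ?_
    simp only [eval_mul, eval_X]
    ring
  rw [integral_sub (integrable_eval_mul_gaussian _) (integrable_eval_mul_gaussian _)] at h
  linarith

/-- The raising operator `X - d/dx` is the adjoint of `d/dx` for the Gaussian weight. -/
lemma integral_hermiteR_succ_mul (k : ℕ) (p : ℝ[X]) :
    ∫ x : ℝ, (p * hermiteR (k + 1)).eval x * Real.exp (-x ^ 2 / 2) =
      ∫ x : ℝ, (derivative p * hermiteR k).eval x * Real.exp (-x ^ 2 / 2) := by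
  have h := integral_derivative_gaussian (p * hermiteR k)
  have e1 : p * hermiteR (k + 1) = X * (p * hermiteR k) - p * derivative (hermiteR k) := by
    rw [hermiteR_succ]; ring
  have e2 : derivative p * hermiteR k =
      derivative (p * hermiteR k) - p * derivative (hermiteR k) := by
    rw [derivative_mul]; ring
  rw [e1, e2]
  simp only [eval_sub, sub_mul]
  rw [integral_sub (integrable_eval_mul_gaussian _) (integrable_eval_mul_gaussian _),
    integral_sub (integrable_eval_mul_gaussian _) (integrable_eval_mul_gaussian _), h]

lemma integral_gaussian_half : ∫ x : ℝ, Real.exp (-x ^ 2 / 2) = Real.sqrt (2 * Real.pi) := by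
  have h := integral_gaussian (1 / 2)
  rw [show Real.pi / (1 / 2) = 2 * Real.pi by ring] at h
  rw [← h]
  congr 1
  ext x
  congr 1
  ring

lemma integral_hermiteR_mul (j k : ℕ) :
    ∫ x : ℝ, (hermiteR j * hermiteR k).eval x * Real.exp (-x ^ 2 / 2) =
      if j = k then (k.factorial : ℝ) * Real.sqrt (2 * Real.pi) else 0 := by
  induction k generalizing j with
  | zero =>
    cases j with
    | zero => simp [hermiteR_zero, integral_gaussian_half]
    | succ j =>
      rw [mul_comm, integral_hermiteR_succ_mul]
      simp [hermiteR_zero]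
  | succ k ih =>
    rw [integral_hermiteR_succ_mul]
    cases j with
    | zero => simp [hermiteR_zero]
    | succ j =>
      have h : ∀ x : ℝ, (derivative (hermiteR (j + 1)) * hermiteR k).eval x *
          Real.exp (-x ^ 2 / 2) =
          ((j : ℝ) + 1) * ((hermiteR j * hermiteR k).eval x * Real.exp (-x ^ 2 / 2)) := by
        intro x
        rw [derivative_hermiteR_succ]
        simp
        ring
      simp_rw [h]
      rw [integral_const_mul, ih]
      by_cases hjk : j = k
      · subst hjk
        simp [Nat.factorial_succ]
        ring
      · simp [hjk]

/-- The normalization of the Hermite functions. -/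
def phiNorm (k : ℕ) : ℝ := Real.sqrt (1 / (Real.sqrt (2 * Real.pi) * (k.factorial : ℝ)))

lemma phi_eq (k : ℕ) (x : ℝ) :
    phi k x = phiNorm k * (hermiteR k).eval x * Real.exp (-x ^ 2 / 4) := by
  rw [phi, aeval_hermite, phiNorm]

lemma phiNorm_succ (k : ℕ) : Real.sqrt ((k : ℝ) + 1) * phiNorm (k + 1) = phiNorm k := by
  rw [phiNorm, phiNorm, ← Real.sqrt_mul (by positivity)]
  congr 1
  rw [Nat.factorial_succ]
  push_cast
  have : Real.sqrt (2 * Real.pi) ≠ 0 := by positivity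
  field_simp

lemma phi_mul_phi (j k : ℕ) (x : ℝ) : phi j x * phi k x =
    phiNorm j * phiNorm k * ((hermiteR j * hermiteR k).eval x * Real.exp (-x ^ 2 / 2)) := by
  rw [phi_eq, phi_eq, eval_mul]
  have : Real.exp (-x ^ 2 / 2) = Real.exp (-x ^ 2 / 4) * Real.exp (-x ^ 2 / 4) := by
    rw [← Real.exp_add]; congr 1; ring
  rw [this]
  ring

lemma continuous_phi (k : ℕ) : Continuous (phi k) := by
  have : phi k = fun x => phiNorm k * (hermiteR k).eval x * Real.exp (-x ^ 2 / 4) :=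
    funext (phi_eq k)
  rw [this]
  fun_prop

lemma integrable_phi_mul_phi (j k : ℕ) : Integrable fun x => phi j x * phi k x := by
  simp_rw [phi_mul_phi]
  exact (integrable_eval_mul_gaussian _).const_mul _

/-- The Hermite functions are orthonormal. -/
lemma integral_phi_mul_phi (j k : ℕ) : ∫ x, phi j x * phi k x = if j = k then 1 else 0 := by
  simp_rw [phi_mul_phi]
  rw [integral_const_mul, integral_hermiteR_mul]
  by_cases h : j = k
  · subst h
    simp only [if_true]
    rw [phiNorm, Real.mul_self_sqrt (by positivity)]
    have : Real.sqrt (2 * Real.pi) ≠ 0 := by positivity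
    field_simp
  · simp [h]

lemma phi_add_two (k : ℕ) (x : ℝ) : Real.sqrt ((k : ℝ) + 2) * phi (k + 2) x =
    x * phi (k + 1) x - Real.sqrt ((k : ℝ) + 1) * phi k x := by
  have h1 := phiNorm_succ k
  have h2 := phiNorm_succ (k + 1)
  have h3 : Real.sqrt ((k : ℝ) + 1) * Real.sqrt ((k : ℝ) + 1) = (k : ℝ) + 1 :=
    Real.mul_self_sqrt (by positivity)
  push_cast at h2
  rw [show (k : ℝ) + 1 + 1 = k + 2 by ring] at h2
  rw [phi_eq, phi_eq, phi_eq, hermiteR_add_two, ← mul_assoc, ← mul_assoc, h2, ← h1]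
  simp only [eval_sub, eval_mul, eval_X, eval_C]
  linear_combination ((phiNorm (k + 1) * eval x (hermiteR k) * Real.exp (-x ^ 2 / 4))) * h3

/-- A bound for the Hermite functions on `[-R, R]`. -/
def phiBound (R : ℝ) (k : ℕ) : ℝ := ∏ j ∈ Finset.range k, (1 + R / Real.sqrt ((j : ℝ) + 1))

lemma phiBound_succ (R : ℝ) (k : ℕ) :
    phiBound R (k + 1) = phiBound R k * (1 + R / Real.sqrt ((k : ℝ) + 1)) :=
  Finset.prod_range_succ _ _

lemma one_le_phiBound {R : ℝ} (hR : 0 ≤ R) (k : ℕ) : 1 ≤ phiBound R k := by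
  induction k with
  | zero => simp [phiBound]
  | succ k ih =>
    rw [phiBound_succ]
    have : 0 ≤ R / Real.sqrt ((k : ℝ) + 1) := by positivity
    nlinarith

lemma phiBound_pos {R : ℝ} (hR : 0 ≤ R) (k : ℕ) : 0 < phiBound R k :=
  zero_lt_one.trans_le (one_le_phiBound hR k)

lemma phiNorm_zero_le : phiNorm 0 ≤ 1 := by
  rw [phiNorm, Real.sqrt_le_left zero_le_one, one_pow, Nat.factorial_zero, Nat.cast_one, mul_one,
    div_le_one (by positivity), Real.one_le_sqrt]
  linarith [Real.pi_gt_three]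

/-- Induction on the normalized three-term recurrence. Since `√(k+1) ≤ √(k+2)`, dividing by `√(k+2)`
leaves exactly the factor `1 + R / √(k+2)`. This is crude, but a bound negligible against `q ^ (-k)`
suffices. -/
lemma abs_phi_le_phiBound {R x : ℝ} (hx : |x| ≤ R) (k : ℕ) : |phi k x| ≤ phiBound R k := by
  have hR : 0 ≤ R := (abs_nonneg x).trans hx
  have h0 : |phi 0 x| ≤ 1 := by
    rw [phi_eq, hermiteR_zero, eval_one, mul_one, abs_mul, Real.abs_exp,
      abs_of_nonneg (show 0 ≤ phiNorm 0 from Real.sqrt_nonneg _)]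
    refine mul_le_one₀ phiNorm_zero_le (Real.exp_pos _).le ?_
    rw [Real.exp_le_one_iff]
    nlinarith [sq_nonneg x]
  induction k using Nat.twoStepInduction with
  | zero => simpa [phiBound] using h0
  | one =>
    have h1 : phi 1 x = x * phi 0 x := by
      have := phiNorm_succ 0
      simp only [Nat.cast_zero, zero_add, Real.sqrt_one, one_mul] at this
      rw [phi_eq, phi_eq, hermiteR_succ, this]
      simp [hermiteR_zero]
      ring
    rw [h1, abs_mul]
    simp only [phiBound, Finset.prod_range_one, Nat.cast_zero, zero_add, Real.sqrt_one, div_one]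
    nlinarith [abs_nonneg x, abs_nonneg (phi 0 x)]
  | more k ih1 ih2 =>
    have hs : 0 < Real.sqrt ((k : ℝ) + 2) := by positivity
    have hs1 : Real.sqrt ((k : ℝ) + 1) ≤ Real.sqrt ((k : ℝ) + 2) :=
      Real.sqrt_le_sqrt (by linarith)
    have hb := phiBound_pos hR k
    have hb1 := phiBound_pos hR (k + 1)
    have hmono : phiBound R k ≤ phiBound R (k + 1) := by
      rw [phiBound_succ]
      have : 0 ≤ R / Real.sqrt ((k : ℝ) + 1) := by positivity
      nlinarith
    have key : Real.sqrt ((k : ℝ) + 2) * |phi (k + 2) x| ≤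
        (Real.sqrt ((k : ℝ) + 2) + R) * phiBound R (k + 1) := by
      rw [← abs_of_pos hs, ← abs_mul, phi_add_two, abs_of_pos hs]
      calc |x * phi (k + 1) x - Real.sqrt ((k : ℝ) + 1) * phi k x|
          ≤ |x * phi (k + 1) x| + |Real.sqrt ((k : ℝ) + 1) * phi k x| := abs_sub _ _
        _ = |x| * |phi (k + 1) x| + Real.sqrt ((k : ℝ) + 1) * |phi k x| := by
            rw [abs_mul, abs_mul, abs_of_nonneg (Real.sqrt_nonneg ((k : ℝ) + 1))]
        _ ≤ R * phiBound R (k + 1) + Real.sqrt ((k : ℝ) + 2) * phiBound R (k + 1) := by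
            gcongr
            exact ih1.trans hmono
        _ = _ := by ring
    rw [phiBound_succ]
    push_cast
    rw [show (k : ℝ) + 1 + 1 = k + 2 by ring]
    rw [← mul_le_mul_iff_right₀ hs]
    refine key.trans (le_of_eq ?_)
    field_simp

/-- Consecutive bounds have ratio tending to `1`, so the ratio test has limit `q` whatever the power
`p`. -/
lemma summable_phiBound_pow_mul {q : ℝ} (hq0 : 0 < q) (hq1 : q < 1) {R : ℝ} (hR : 0 ≤ R) (p : ℕ) :
    Summable fun k => phiBound R k ^ p * q ^ k := by
  have hpos := phiBound_pos hR
  refine summable_of_ratio_test_tendsto_lt_one (l := q) hq1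
    (Eventually.of_forall fun k => (mul_pos (pow_pos (hpos k) p) (pow_pos hq0 k)).ne') ?_
  have h1 : ∀ k : ℕ, ‖phiBound R (k + 1) ^ p * q ^ (k + 1)‖ / ‖phiBound R k ^ p * q ^ k‖ =
      (1 + R / Real.sqrt ((k : ℝ) + 1)) ^ p * q := by
    intro k
    have := hpos k
    have h2 : 0 ≤ R / Real.sqrt ((k : ℝ) + 1) := by positivity
    rw [Real.norm_of_nonneg (by have := hpos (k + 1); positivity),
      Real.norm_of_nonneg (by positivity), phiBound_succ, mul_pow]
    field_simp
    exact pow_succ q k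
  simp_rw [h1]
  have h2 : Tendsto (fun k : ℕ => Real.sqrt ((k : ℝ) + 1)) atTop atTop :=
    Real.tendsto_sqrt_atTop.comp
      (tendsto_atTop_add_const_right _ _ tendsto_natCast_atTop_atTop)
  have h3 := ((((h2.const_div_atTop R).const_add 1).pow p).mul_const q)
  simpa using h3

end Hermite

/-! ### Principal minors and the finite determinant identities -/

section Minors

open Matrix

variable {ι R : Type*} [DecidableEq ι] [CommRing R]

/-- The principal minor of `M` with rows and columns in `S`. -/
def principalMinor (M : Matrix ι ι R) (S : Finset ι) : R :=
  (M.submatrix (Subtype.val : S → ι) (Subtype.val : S → ι)).det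

lemma principalMinor_eq_det {κ : Type*} [Fintype κ] [DecidableEq κ] (M : Matrix ι ι R)
    (f : κ ↪ ι) : principalMinor M (Finset.univ.map f) = (M.submatrix f f).det := by
  let e : κ ≃ (Finset.univ.map f : Finset ι) :=
    Equiv.ofBijective (fun k => ⟨f k, by simp⟩)
      ⟨fun a b h => f.injective (congrArg Subtype.val h), fun ⟨x, hx⟩ => by
        obtain ⟨k, -, hk⟩ := Finset.mem_map.1 hx
        exact ⟨k, Subtype.ext hk⟩⟩
  rw [principalMinor, ← Matrix.det_submatrix_equiv_self e]
  rfl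

/-- By multilinearity in the rows, each row is taken from `M` (indices in `s`) or from the identity.
-/
lemma det_one_add_eq_sum_principalMinor [Fintype ι] (M : Matrix ι ι R) :
    (1 + M).det = ∑ s : Finset ι, principalMinor M s := by
  have h := (detRowAlternating : (ι → R) [⋀^ι]→ₗ[R] R).map_add_univ M (1 : Matrix ι ι R)
  rw [add_comm]
  refine h.trans (Finset.sum_congr rfl fun s _ => ?_)
  exact Matrix.det_piecewise_one_eq_submatrix_det M s

lemma principalMinor_one_add (M : Matrix ι ι R) (U : Finset ι) :
    principalMinor (1 + M) U = ∑ S ∈ U.powerset, principalMinor M S := by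
  have h1 : (1 + M).submatrix (Subtype.val : U → ι) (Subtype.val : U → ι) =
      1 + M.submatrix (Subtype.val : U → ι) (Subtype.val : U → ι) := by
    rw [Matrix.submatrix_add, Pi.add_apply, Pi.add_apply,
      Matrix.submatrix_one _ Subtype.val_injective]
  rw [principalMinor, h1, det_one_add_eq_sum_principalMinor]
  refine Finset.sum_bij' (fun s _ => s.map (Function.Embedding.subtype _))
    (fun S _ => S.subtype (· ∈ U)) ?_ ?_ ?_ ?_ ?_
  · intro s _
    refine Finset.mem_powerset.2 ?_
    intro x hx
    obtain ⟨y, -, rfl⟩ := Finset.mem_map.1 hx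
    exact y.2
  · exact fun _ _ => Finset.mem_univ _
  · intro s _
    ext x
    simp
  · intro S hS
    rw [Finset.subtype_map, Finset.filter_true_of_mem]
    exact fun x hx => Finset.mem_powerset.1 hS hx
  · intro s _
    have h2 : s.map (Function.Embedding.subtype _) =
        Finset.univ.map ((Function.Embedding.subtype (· ∈ s)).trans
          (Function.Embedding.subtype (· ∈ U))) := by
      ext x
      simp
    rw [h2, principalMinor_eq_det]
    rfl

lemma principalMinor_row_mul (w : ι → R) (M : Matrix ι ι R) (S : Finset ι) :
    principalMinor (Matrix.of fun i j => w i * M i j) S =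
      (∏ i ∈ S, w i) * principalMinor M S := by
  rw [principalMinor, principalMinor, ← Finset.prod_coe_sort S, ← Matrix.det_mul_column]
  rfl

/-- Both sums are determinants on `U` of a perturbed identity, and row by row `(1 + w_i)(δ_ij - w_i
/ (1 + w_i) N_ij) = δ_ij + w_i (δ_ij - N_ij)`. -/
lemma prod_one_add_mul_sum_principalMinor {K : Type*} [Field K] (w : ι → K) (N : Matrix ι ι K)
    (U : Finset ι) (hw : ∀ i, 1 + w i ≠ 0) :
    (∏ i ∈ U, (1 + w i)) *
        ∑ S ∈ U.powerset, (∏ i ∈ S, -(w i / (1 + w i))) * principalMinor N S =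
      ∑ S ∈ U.powerset, (∏ i ∈ S, w i) * principalMinor (1 - N) S := by
  simp_rw [← principalMinor_row_mul]
  rw [← principalMinor_one_add, ← principalMinor_one_add, ← principalMinor_row_mul]
  congr 1
  ext i j
  have := hw i
  simp only [of_apply, Matrix.add_apply, Matrix.sub_apply]
  by_cases h : i = j
  · subst h
    simp only [one_apply_eq]
    field_simp
    ring
  · simp only [one_apply_ne h]
    field_simp
    ring

/-- The Gram matrix of the vectors `(v k i)_{k ∈ S}` with weights `d`. -/
def gram {m : ℕ} (d : ι → R) (v : ι → Fin m → R) (S : Finset ι) : Matrix (Fin m) (Fin m) R :=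
  Matrix.of fun i j => ∑ k ∈ S, d k * v k i * v k j

/-- The perturbation factors through `Fin m`, so `det (1 + AB) = det (1 + BA)` replaces a
determinant of size `S.card` by one of size `m`. -/
lemma principalMinor_one_add_rank {m : ℕ} (t : R) (d : ι → R) (v : ι → Fin m → R) (S : Finset ι) :
    principalMinor (1 + Matrix.of fun k l => d k * (t * ∑ i, v k i * v l i)) S =
      (1 + t • gram d v S).det := by
  let A : Matrix S (Fin m) R := Matrix.of fun k i => t * d k * v k i
  let B : Matrix (Fin m) S R := Matrix.of fun i l => v l i
  have h1 : (1 + Matrix.of fun k l => d k * (t * ∑ i, v k i * v l i)).submatrix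
      (Subtype.val : S → ι) (Subtype.val : S → ι) = 1 + A * B := by
    ext k l
    simp only [submatrix_apply, Matrix.add_apply, of_apply, mul_apply, A, B, one_apply, Subtype.ext_iff,
      Finset.mul_sum]
    congr 1
    exact Finset.sum_congr rfl fun i _ => by ring
  have h2 : 1 + t • gram d v S = 1 + B * A := by
    ext i j
    simp only [gram, Matrix.add_apply, Matrix.smul_apply, of_apply, mul_apply, A, B, smul_eq_mul,
      Finset.mul_sum]
    congr 1
    rw [← Finset.sum_coe_sort S]
    exact Finset.sum_congr rfl fun i _ => by ring
  rw [principalMinor, h1, h2, Matrix.det_one_add_mul_comm]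

/-- The top coefficient in `t` of the same identity with `1 + t • gram` in place of `gram`; that
version is the gap identity for a matrix of rank at most `m`. -/
lemma prod_one_add_mul_det_gram {m : ℕ} (w : ι → ℂ) (v : ι → Fin m → ℂ)
    (U : Finset ι) (hw : ∀ i, 1 + w i ≠ 0) :
    (∏ i ∈ U, (1 + w i)) * (gram (fun k => w k / (1 + w k)) v U).det =
      ∑ S ∈ U.powerset, (∏ i ∈ S, w i) * (gram 1 v S).det := by
  have h1 : ∀ t : ℂ, (∏ i ∈ U, (1 + w i)) * (1 + t • gram (fun k => w k / (1 + w k)) v U).det =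
      ∑ S ∈ U.powerset, (∏ i ∈ S, w i) * (1 + t • gram 1 v S).det := by
    intro t
    have h := prod_one_add_mul_sum_principalMinor w
      (Matrix.of fun k l => -(t * ∑ i, v k i * v l i)) U hw
    have h2 : ∑ S ∈ U.powerset, (∏ i ∈ S, -(w i / (1 + w i))) *
        principalMinor (Matrix.of fun k l => -(t * ∑ i, v k i * v l i)) S =
        (1 + t • gram (fun k => w k / (1 + w k)) v U).det := by
      simp_rw [← principalMinor_row_mul]
      rw [← principalMinor_one_add, ← principalMinor_one_add_rank]
      simp only [of_apply, neg_mul_neg]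
    rw [← h2, h]
    refine Finset.sum_congr rfl fun S _ => ?_
    rw [← principalMinor_one_add_rank]
    congr 3
    ext k l
    simp [sub_neg_eq_add]
  -- With `t = s⁻¹`, multiplying by `s ^ m` makes the top coefficient in `t` the value at `s = 0`,
  -- reached by continuity.
  have h2 : ∀ s : ℂ, s ≠ 0 →
      (∏ i ∈ U, (1 + w i)) * (s • 1 + gram (fun k => w k / (1 + w k)) v U).det =
      ∑ S ∈ U.powerset, (∏ i ∈ S, w i) * (s • 1 + gram 1 v S).det := by
    intro s hs
    have h3 : ∀ A : Matrix (Fin m) (Fin m) ℂ, (s • 1 + A).det = s ^ m * (1 + s⁻¹ • A).det := by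
      intro A
      rw [show s • 1 + A = s • (1 + s⁻¹ • A) by rw [smul_add, smul_inv_smul₀ hs], det_smul,
        Fintype.card_fin]
    simp_rw [h3]
    rw [mul_left_comm, h1, Finset.mul_sum]
    exact Finset.sum_congr rfl fun S _ => by ring
  have hc : ∀ A : Matrix (Fin m) (Fin m) ℂ, Continuous fun s : ℂ => (s • 1 + A).det := fun A =>
    Continuous.matrix_det (by fun_prop)
  have h4 := Continuous.ext_on (dense_compl_singleton (0 : ℂ))
    (continuous_const.mul (hc (gram (fun k => w k / (1 + w k)) v U)))
    (continuous_finsetSum U.powerset fun S _ =>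
      (continuous_const (y := ∏ i ∈ S, w i)).mul (hc (gram 1 v S))) h2
  simpa using congrFun h4 0

end Minors

/-! ### Bounds and limits for sums over finite sets of levels -/

section Summation

/-- The maximum of a set of naturals is at least the number of its other elements. This distributes
the `S.card !` terms of a Leibniz expansion over the elements of `S`, so that bounds on minors
become products over `S`. -/
lemma factorial_card_le_prod (S : Finset ℕ) : S.card.factorial ≤ ∏ i ∈ S, (i + 1) := by
  induction S using Finset.induction_on_max with
  | empty => simp
  | insert a S hS ih =>
    have ha : a ∉ S := fun h => lt_irrefl _ (hS a h)
    have hc : S.card ≤ a := by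
      simpa using Finset.card_le_card (fun x hx => Finset.mem_range.2 (hS x hx) : S ⊆ Finset.range a)
    rw [Finset.card_insert_of_notMem ha, Finset.prod_insert ha, Nat.factorial_succ]
    gcongr

lemma norm_det_le {κ : Type*} [Fintype κ] [DecidableEq κ] (A : Matrix κ κ ℂ) (a : κ → ℝ)
    (h : ∀ i j, ‖A i j‖ ≤ a i) :
    ‖A.det‖ ≤ (Fintype.card κ).factorial * ∏ i, a i := by
  rw [← Matrix.det_transpose, Matrix.det_apply]
  refine (norm_sum_le _ _).trans ?_
  have : ∀ σ ∈ (Finset.univ : Finset (Equiv.Perm κ)),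
      ‖Equiv.Perm.sign σ • ∏ i, A.transpose (σ i) i‖ ≤ ∏ i, a i := by
    intro σ _
    rw [Units.smul_def, zsmul_eq_mul, norm_mul, norm_prod]
    have h1 : ‖((Equiv.Perm.sign σ : ℤ) : ℂ)‖ = 1 := by
      rcases Int.units_eq_one_or (Equiv.Perm.sign σ) with h | h <;> simp [h]
    rw [h1, one_mul]
    exact Finset.prod_le_prod (fun _ _ => norm_nonneg _) fun i _ => h i _
  refine (Finset.sum_le_card_nsmul _ _ _ this).trans (le_of_eq ?_)
  rw [Finset.card_univ, Fintype.card_perm, nsmul_eq_mul]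

lemma norm_principalMinor_le (M : Matrix ℕ ℕ ℂ) (S : Finset ℕ) (a : ℕ → ℝ)
    (h : ∀ i j, ‖M i j‖ ≤ a i) :
    ‖principalMinor M S‖ ≤ ∏ i ∈ S, (((i : ℝ) + 1) * a i) := by
  have ha : ∀ i, 0 ≤ a i := fun i => (norm_nonneg _).trans (h i i)
  refine (norm_det_le _ (fun i : S => a i) fun i j => h i j).trans ?_
  rw [Fintype.card_coe, Finset.prod_mul_distrib, Finset.prod_coe_sort S a]
  refine mul_le_mul_of_nonneg_right ?_ (Finset.prod_nonneg fun i _ => ha i)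
  exact_mod_cast factorial_card_le_prod S

lemma summable_succ_mul_geometric {q : ℝ} (hq0 : 0 < q) (hq1 : q < 1) :
    Summable fun k : ℕ => ((k : ℝ) + 1) * q ^ k := by
  have h1 := summable_pow_mul_geometric_of_norm_lt_one 1
    (show ‖q‖ < 1 by rwa [Real.norm_of_nonneg hq0.le])
  have h2 := summable_geometric_of_lt_one hq0.le hq1
  refine (h1.add h2).congr fun k => ?_
  ring

/-- The finite identity on `U` passes to the limit because the power sets of finite sets exhaust all
finite sets. -/
lemma tsum_principalMinor_gap {w : ℕ → ℂ} (hw : ∀ i, 1 + w i ≠ 0) (N : Matrix ℕ ℕ ℂ)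
    (h1 : Summable fun S : Finset ℕ => (∏ i ∈ S, -(w i / (1 + w i))) * principalMinor N S)
    (h2 : Summable fun S : Finset ℕ => (∏ i ∈ S, w i) * principalMinor (1 - N) S)
    (h3 : Multipliable fun i => 1 + w i) :
    (∏' i, (1 + w i)) * ∑' S : Finset ℕ, (∏ i ∈ S, -(w i / (1 + w i))) * principalMinor N S =
      ∑' S : Finset ℕ, (∏ i ∈ S, w i) * principalMinor (1 - N) S := by
  refine tendsto_nhds_unique (Tendsto.mul h3.hasProd
    (h1.hasSum.comp tendsto_finset_powerset_atTop_atTop)) ?_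
  refine (h2.hasSum.comp tendsto_finset_powerset_atTop_atTop).congr fun U => ?_
  exact (prod_one_add_mul_sum_principalMinor w N U hw).symm

lemma tprod_one_add_mul_det {m : ℕ} {w : ℕ → ℂ} (hw : ∀ i, 1 + w i ≠ 0) (v : ℕ → Fin m → ℂ)
    (h1 : ∀ i j, Summable fun k => w k / (1 + w k) * v k i * v k j)
    (h2 : Summable fun S : Finset ℕ => (∏ i ∈ S, w i) * (gram 1 v S).det)
    (h3 : Multipliable fun i => 1 + w i) :
    (∏' i, (1 + w i)) *
        (Matrix.of fun i j => ∑' k, w k / (1 + w k) * v k i * v k j).det =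
      ∑' S : Finset ℕ, (∏ i ∈ S, w i) * (gram 1 v S).det := by
  have h4 : Tendsto (fun U : Finset ℕ => gram (fun k => w k / (1 + w k)) v U) atTop
      (𝓝 (Matrix.of fun i j => ∑' k, w k / (1 + w k) * v k i * v k j)) := by
    refine tendsto_pi_nhds.2 fun i => tendsto_pi_nhds.2 fun j => ?_
    exact (h1 i j).hasSum
  have h5 := ((Continuous.matrix_det (A := fun A : Matrix (Fin m) (Fin m) ℂ => A)
    continuous_id).tendsto _).comp h4
  refine tendsto_nhds_unique (Tendsto.mul h3.hasProd h5) ?_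
  refine (h2.hasSum.comp tendsto_finset_powerset_atTop_atTop).congr fun U => ?_
  exact (prod_one_add_mul_det_gram w v U hw).symm

end Summation

/-! ### Fredholm determinants as series of principal minors -/

section FredholmSeries

variable {H : Type*} [NormedAddCommGroup H] [InnerProductSpace ℂ H]

lemma det_eq_det_inner {V ι : Type*} [NormedAddCommGroup V] [InnerProductSpace ℂ V] [Fintype ι]
    [DecidableEq ι] (e : OrthonormalBasis ι ℂ V) (L : V →ₗ[ℂ] V) :
    LinearMap.det L = (Matrix.of fun i j => inner ℂ (e i) (L (e j))).det := by
  rw [← LinearMap.det_toMatrix e.toBasis]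
  congr 1
  ext i j
  simp [LinearMap.toMatrix_apply, OrthonormalBasis.repr_apply_apply]

/-- The determinant of `I + ∑_k ⟨u_k, ·⟩ v_k` on a finite-dimensional space is the sum of the
principal minors of the Gram matrix `⟨u_j, v_k⟩`. -/
lemma det_one_add_eq_tsum {V : Type*} [NormedAddCommGroup V] [InnerProductSpace ℂ V]
    [FiniteDimensional ℂ V] (u v : ℕ → V) (L : V →ₗ[ℂ] V)
    (hL : ∀ f, HasSum (fun k => inner ℂ (u k) f • v k) (L f - f))
    (hs : Summable fun S : Finset ℕ =>
      principalMinor (Matrix.of fun j k => inner ℂ (u j) (v k)) S) :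
    LinearMap.det L =
      ∑' S : Finset ℕ, principalMinor (Matrix.of fun j k => inner ℂ (u j) (v k)) S := by
  let e := stdOrthonormalBasis ℂ V
  let A : ∀ U : Finset ℕ, Matrix (Fin (Module.finrank ℂ V)) U ℂ := fun U =>
    Matrix.of fun i k => inner ℂ (e i) (v k)
  let B : ∀ U : Finset ℕ, Matrix U (Fin (Module.finrank ℂ V)) ℂ := fun U =>
    Matrix.of fun k j => inner ℂ (u k) (e j)
  have h1 : Tendsto (fun U => 1 + A U * B U) atTop
      (𝓝 (Matrix.of fun i j => inner ℂ (e i) (L (e j)))) := by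
    refine tendsto_pi_nhds.2 fun i => tendsto_pi_nhds.2 fun j => ?_
    have h2 := ((innerSL ℂ (e i)).hasSum (hL (e j)))
    have h3 := Tendsto.const_add (inner ℂ (e i) (e j)) h2
    simp only [innerSL_apply_apply, inner_sub_right, add_sub_cancel] at h3
    refine h3.congr fun U => ?_
    rw [Matrix.add_apply, Matrix.mul_apply, ← Finset.sum_coe_sort U,
      orthonormal_iff_ite.1 e.orthonormal i j, Matrix.one_apply]
    congr 1
    refine Finset.sum_congr rfl fun k _ => ?_
    simp [A, B, inner_smul_right, mul_comm]
  have h4 := ((Continuous.matrix_det (A := fun A : Matrix (Fin (Module.finrank ℂ V)) _ ℂ => A)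
    continuous_id).tendsto _).comp h1
  rw [det_eq_det_inner e]
  refine tendsto_nhds_unique h4 ?_
  refine (hs.hasSum.comp tendsto_finset_powerset_atTop_atTop).congr fun U => ?_
  simp only [Function.comp_apply]
  -- Truncating the operator to `k ∈ U` gives `1 + A B`; after the swap, Parseval turns `B A` into
  -- the Gram matrix on `U`.
  rw [← principalMinor_one_add, Matrix.det_one_add_mul_comm, principalMinor]
  congr 1
  have h5 : B U * A U = (Matrix.of fun j k => inner ℂ (u j) (v k)).submatrix
      (Subtype.val : U → ℕ) (Subtype.val : U → ℕ) := by
    ext j k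
    simp only [Matrix.mul_apply, A, B, Matrix.of_apply, Matrix.submatrix_apply]
    exact e.sum_inner_mul_inner _ _
  rw [h5, Matrix.submatrix_add, Pi.add_apply, Pi.add_apply,
      Matrix.submatrix_one _ Subtype.val_injective]

/-- Compressing to `V` replaces `u_k` and `v_k` by their projections. These do not increase norms,
so the series of minors has a majorant independent of `V` and dominated convergence applies. The
weight `k + 1` in `ha` pays for the Leibniz bound on minors. -/
lemma compressionDet_tendsto (u v : ℕ → H) (a : ℕ → ℝ) (hu : ∀ k, ‖u k‖ ≤ a k)
    (hv : ∀ k, ‖v k‖ ≤ 1) (ha : Summable fun k : ℕ => ((k : ℝ) + 1) * a k)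
    (B : H →L[ℂ] H) (hB : ∀ f, HasSum (fun k => inner ℂ (u k) f • v k) (B f - f)) :
    Tendsto (compressionDet B) atTop
      (𝓝 (∑' S : Finset ℕ, principalMinor (Matrix.of fun j k => inner ℂ (u j) (v k)) S)) := by
  have ha0 : ∀ k, 0 ≤ a k := fun k => (norm_nonneg _).trans (hu k)
  have hsum : Summable fun S : Finset ℕ => ∏ k ∈ S, (((k : ℝ) + 1) * a k) :=
    summable_finsetProd_of_summable_nonneg (fun k => mul_nonneg (by positivity) (ha0 k)) ha
  let G : {V : Submodule ℂ H // V.FG} → Matrix ℕ ℕ ℂ := fun V =>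
    haveI : FiniteDimensional ℂ V.1 := Module.Finite.iff_fg.2 V.2
    Matrix.of fun j k => inner ℂ (V.1.orthogonalProjectionOnto (u j))
      (V.1.orthogonalProjectionOnto (v k))
  have hb : ∀ V S, ‖principalMinor (G V) S‖ ≤ ∏ k ∈ S, (((k : ℝ) + 1) * a k) := by
    intro V S
    refine norm_principalMinor_le _ _ _ fun i j => ?_
    have : FiniteDimensional ℂ V.1 := Module.Finite.iff_fg.2 V.2
    calc _ ≤ ‖V.1.orthogonalProjectionOnto (u i)‖ * ‖V.1.orthogonalProjectionOnto (v j)‖ :=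
          norm_inner_le_norm _ _
      _ ≤ a i * 1 := by
          gcongr
          · exact ha0 i
          · exact (V.1.norm_orthogonalProjectionOnto_apply_le _).trans (hu i)
          · exact (V.1.norm_orthogonalProjectionOnto_apply_le _).trans (hv j)
      _ = a i := mul_one _
  have h1 : compressionDet B = fun V => ∑' S : Finset ℕ, principalMinor (G V) S := by
    funext V
    have : FiniteDimensional ℂ V.1 := Module.Finite.iff_fg.2 V.2
    refine det_one_add_eq_tsum (fun k => V.1.orthogonalProjectionOnto (u k))
      (fun k => V.1.orthogonalProjectionOnto (v k)) _ (fun f => ?_)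
      (hsum.of_norm_bounded (hb V))
    have h2 := V.1.orthogonalProjectionOnto.hasSum (hB f)
    simp only [map_sub, map_smul] at h2
    simpa using h2
  rw [h1]
  refine tendsto_tsum_of_dominated_convergence hsum (fun S => ?_)
    (Eventually.of_forall fun V S => hb V S)
  -- A single minor involves finitely many vectors, so it is constant once `V` contains them.
  have hfg : (Submodule.span ℂ (u '' (S : Set ℕ) ∪ v '' (S : Set ℕ))).FG :=
    Submodule.fg_span ((S.finite_toSet.image _).union (S.finite_toSet.image _))
  refine tendsto_const_nhds.congr' ?_
  filter_upwards [eventually_ge_atTop ⟨_, hfg⟩] with V hV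
  have : FiniteDimensional ℂ V.1 := Module.Finite.iff_fg.2 V.2
  have hV' : Submodule.span ℂ (u '' (S : Set ℕ) ∪ v '' (S : Set ℕ)) ≤ V.1 := hV
  rw [principalMinor, principalMinor]
  congr 1
  ext j k
  have hj : u j ∈ V.1 := hV' (Submodule.subset_span (Or.inl ⟨j, j.2, rfl⟩))
  simp only [Matrix.submatrix_apply, Matrix.of_apply, G]
  rw [Submodule.inner_orthogonalProjectionOnto_eq_of_mem_left]
  rw [show V.1.orthogonalProjectionOnto (u j) = ⟨u j, hj⟩ from
    V.1.orthogonalProjectionOnto_mem_subspace_eq_self ⟨u j, hj⟩]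

lemma hasFredholmDet_of_hasSum (u v : ℕ → H) (a : ℕ → ℝ) (hu : ∀ k, ‖u k‖ ≤ a k)
    (hv : ∀ k, ‖v k‖ ≤ 1) (ha : Summable fun k : ℕ => ((k : ℝ) + 1) * a k)
    (B : H →L[ℂ] H) (hB : ∀ f, HasSum (fun k => inner ℂ (u k) f • v k) (B f - f)) :
    HasFredholmDet B
      (∑' S : Finset ℕ, principalMinor (Matrix.of fun j k => inner ℂ (u j) (v k)) S) := by
  refine ⟨⟨u, v, ?_, fun f => by simpa using hB f⟩, compressionDet_tendsto u v a hu hv ha B hB⟩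
  refine Summable.of_nonneg_of_le (fun k => by positivity) (fun k => ?_) ha
  have ha0 : 0 ≤ a k := (norm_nonneg _).trans (hu k)
  have hk : (0 : ℝ) ≤ k := Nat.cast_nonneg k
  have := mul_le_mul (hu k) (hv k) (norm_nonneg _) ha0
  nlinarith

end FredholmSeries

/-! ### The operator with the Mehler-type kernel and its determinant -/

section Operator

lemma memLp_phi (k : ℕ) : MemLp (fun x : ℝ => (phi k x : ℂ)) 2 volume := by
  have hc : Continuous fun x : ℝ => (phi k x : ℂ) :=
    Complex.continuous_ofReal.comp (continuous_phi k)
  rw [memLp_two_iff_integrable_sq_norm hc.aestronglyMeasurable]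
  refine (integrable_phi_mul_phi k k).congr (Eventually.of_forall fun x => ?_)
  simp [sq]

/-- The Hermite function `φ_k` as an element of `L²(ℝ)`. -/
def phiL (k : ℕ) : L2R := (memLp_phi k).toLp _

lemma phiL_ae (k : ℕ) : phiL k =ᵐ[volume] fun x => (phi k x : ℂ) := (memLp_phi k).coeFn_toLp

lemma inner_phiL_left (k : ℕ) (f : L2R) : inner ℂ (phiL k) f = ∫ x, (phi k x : ℂ) * f x := by
  rw [L2.inner_def]
  refine integral_congr_ae ?_
  filter_upwards [phiL_ae k] with x hx
  rw [hx, RCLike.inner_apply', Complex.conj_ofReal]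

lemma inner_phiL_phiL (j k : ℕ) : inner ℂ (phiL j) (phiL k) = if j = k then 1 else 0 := by
  rw [inner_phiL_left]
  have h : ∫ x, (phi j x : ℂ) * phiL k x = ∫ x, ((phi j x * phi k x : ℝ) : ℂ) := by
    refine integral_congr_ae ?_
    filter_upwards [phiL_ae k] with x hx
    rw [hx, Complex.ofReal_mul]
  rw [h, integral_complex_ofReal, integral_phi_mul_phi]
  split_ifs <;> simp

lemma norm_phiL (k : ℕ) : ‖phiL k‖ = 1 := by
  have h := inner_phiL_phiL k k
  rw [inner_self_eq_norm_sq_to_K, if_pos rfl] at h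
  have h2 : ‖phiL k‖ ^ 2 = 1 := by
    apply Complex.ofReal_injective
    simpa using h
  exact (pow_eq_one_iff_of_nonneg (norm_nonneg _) two_ne_zero).1 h2

lemma norm_inner_phiL_le (k : ℕ) (f : L2R) : ‖(inner ℂ (phiL k) f : ℂ)‖ ≤ ‖f‖ := by
  simpa [norm_phiL] using norm_inner_le_norm (𝕜 := ℂ) (phiL k) f

/-- An `L²`-convergent Hermite series agrees almost everywhere with its pointwise sum. -/
lemma ae_eq_tsum_phi {c : ℕ → ℂ} {g : L2R} (hg : HasSum (fun k => c k • phiL k) g)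
    (hc : ∀ x : ℝ, Summable fun k => c k * (phi k x : ℂ)) :
    g =ᵐ[volume] fun x => ∑' k, c k * (phi k x : ℂ) := by
  -- Convergence in `L²` gives convergence almost everywhere along a subsequence, which suffices
  -- since the full series converges pointwise.
  obtain ⟨ns, hns, hae⟩ := (tendstoInMeasure_of_tendsto_Lp hg.tendsto_sum_nat).exists_seq_tendsto_ae
  have h1 : ∀ᵐ x : ℝ, ∀ N, (∑ k ∈ Finset.range N, c k • phiL k : L2R) x =
      ∑ k ∈ Finset.range N, c k * (phi k x : ℂ) := by
    rw [ae_all_iff]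
    intro N
    have h2 : ∀ᵐ x : ℝ, ∀ k, (c k • phiL k : L2R) x = c k * (phi k x : ℂ) := by
      rw [ae_all_iff]
      intro k
      filter_upwards [phiL_ae k, Lp.coeFn_smul (c k) (phiL k)] with x h3 h4
      rw [h4, Pi.smul_apply, h3, smul_eq_mul]
    filter_upwards [h2, Lp.coeFn_finsetSum (Finset.range N) fun k => c k • phiL k] with x h3 h4
    rw [h4, Finset.sum_apply]
    exact Finset.sum_congr rfl fun k _ => h3 k
  filter_upwards [hae, h1] with x hx h1x
  simp only [h1x] at hx
  exact tendsto_nhds_unique hx ((hc x).hasSum.tendsto_sum_nat.comp hns.tendsto_atTop)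

/-- The rank-one operators have norm `‖d k‖`, so their series converges in operator norm. -/
lemma exists_hasSum_diagonal (d : ℕ → ℂ) (hd : Summable fun k => ‖d k‖) :
    ∃ T : L2R →L[ℂ] L2R,
      ∀ f, HasSum (fun k => (d k * inner ℂ (phiL k) f) • phiL k) (T f) := by
  have hs : Summable fun k => d k • (innerSL ℂ (phiL k)).smulRight (phiL k) := by
    refine Summable.of_norm (hd.congr fun k => ?_)
    rw [norm_smul, ContinuousLinearMap.norm_smulRight_apply, innerSL_apply_norm, norm_phiL]
    simp
  obtain ⟨T, hT⟩ := hs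
  refine ⟨T, fun f => ?_⟩
  have h := (ContinuousLinearMap.apply ℂ L2R f).hasSum hT
  refine h.congr_fun ?_
  intro k
  simp [mul_smul]

lemma isIntegralOperator_diagonal {k : ℝ → ℝ → ℂ} {d : ℕ → ℂ}
    (hk : ∀ x y, k x y = ∑' j, d j * (phi j x : ℂ) * (phi j y : ℂ))
    (hd : ∀ x, Summable fun j => ‖d j * (phi j x : ℂ)‖)
    (hd2 : ∀ x y, Summable fun j => d j * (phi j x : ℂ) * (phi j y : ℂ))
    (T : L2R →L[ℂ] L2R)
    (hT : ∀ f, HasSum (fun k => (d k * inner ℂ (phiL k) f) • phiL k) (T f)) :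
    IsIntegralOperator k T := by
  intro f
  have h1 := ae_eq_tsum_phi (hT f) fun x => by
    refine Summable.of_norm_bounded ((hd x).mul_right ‖f‖) fun j => ?_
    rw [mul_right_comm, norm_mul]
    exact mul_le_mul_of_nonneg_left (norm_inner_phiL_le j f) (norm_nonneg _)
  filter_upwards [h1] with x hx
  -- For fixed `x` this series sums in `L²` to the conjugate of `k x ·`. The integral against the
  -- kernel is thus an inner product, which gives integrability and allows termwise evaluation.
  have hs : Summable fun j => (starRingEnd ℂ) (d j * (phi j x : ℂ)) • phiL j := by
    refine Summable.of_norm ((hd x).congr fun j => ?_)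
    rw [norm_smul, norm_phiL, mul_one, RCLike.norm_conj]
  obtain ⟨g, hg⟩ := hs
  have hgae := ae_eq_tsum_phi hg fun y => by
    have := (hd2 x y).map (starRingEnd ℂ) Complex.continuous_conj
    refine this.congr fun j => ?_
    simp
  have hgk : ∀ᵐ y : ℝ, inner ℂ (g y) (f y) = k x y * f y := by
    filter_upwards [hgae] with y hy
    rw [hy, RCLike.inner_apply', hk, Complex.conj_tsum]
    congr 2
    ext j
    simp
  refine ⟨(L2.integrable_inner g f).congr hgk, ?_⟩
  rw [← integral_congr_ae hgk, ← L2.inner_def, hx]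
  have h2 := (innerSL ℂ f).hasSum hg
  have h3 := h2.map (starRingEnd ℂ) Complex.continuous_conj
  simp only [Function.comp_def, innerSL_apply_apply, inner_conj_symm, inner_smul_left,
    RingHomCompTriple.comp_apply, RingHom.id_apply] at h3
  rw [← h3.tsum_eq]
  congr 1
  ext j
  ring

/-- Identifies the operator chosen in `integralOperator` with the explicit diagonal one. -/
lemma IsIntegralOperator.unique {k : ℝ → ℝ → ℂ} {S T : L2R →L[ℂ] L2R}
    (hS : IsIntegralOperator k S) (hT : IsIntegralOperator k T) : S = T := by
  ext1 f
  apply Lp.ext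
  filter_upwards [hS f, hT f] with x h1 h2
  rw [h1.2, h2.2]

/-- The eigenvalues of `𝐊(z; q)`. -/
def eigenvalue (q : ℝ) (z : ℂ) (k : ℕ) : ℂ := (q : ℂ) ^ k * z / (1 + (q : ℂ) ^ k * z)

variable {q : ℝ} {z : ℂ}

lemma exists_norm_eigenvalue_le (hq0 : 0 < q) (hq1 : q < 1) :
    ∃ C, 0 ≤ C ∧ ∀ k, ‖eigenvalue q z k‖ ≤ C * q ^ k := by
  -- A convergent sequence is bounded. No condition on `z` is needed: a vanishing denominator
  -- contributes `0` by convention.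
  have h1 : Tendsto (fun k : ℕ => z / (1 + (q : ℂ) ^ k * z)) atTop (𝓝 (z / (1 + 0 * z))) := by
    refine Tendsto.div tendsto_const_nhds ?_ (by simp)
    refine Tendsto.const_add _ (Tendsto.mul_const _ ?_)
    refine tendsto_pow_atTop_nhds_zero_of_norm_lt_one ?_
    rwa [Complex.norm_real, Real.norm_of_nonneg hq0.le]
  obtain ⟨C, hC⟩ := (Metric.isBounded_range_of_tendsto _ h1).exists_norm_le
  refine ⟨C, (norm_nonneg _).trans (hC _ ⟨0, rfl⟩), fun k => ?_⟩
  rw [eigenvalue, mul_div_assoc, norm_mul, norm_pow, Complex.norm_real,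
    Real.norm_of_nonneg hq0.le, mul_comm]
  exact mul_le_mul_of_nonneg_right (hC _ ⟨k, rfl⟩) (by positivity)

lemma summable_norm_eigenvalue_mul (hq0 : 0 < q) (hq1 : q < 1) (x y : ℝ) :
    Summable fun k => ‖eigenvalue q z k * (phi k x : ℂ) * (phi k y : ℂ)‖ := by
  obtain ⟨C, hC0, hC⟩ := exists_norm_eigenvalue_le hq0 hq1
  have hR : 0 ≤ max |x| |y| := (abs_nonneg x).trans (le_max_left _ _)
  refine Summable.of_nonneg_of_le (fun _ => norm_nonneg _) (fun k => ?_)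
    ((summable_phiBound_pow_mul hq0 hq1 hR 2).mul_left C)
  rw [norm_mul, norm_mul, Complex.norm_real, Complex.norm_real]
  have h1 := abs_phi_le_phiBound (le_max_left |x| |y|) k
  have h2 := abs_phi_le_phiBound (le_max_right |x| |y|) k
  have h3 := (phiBound_pos hR k).le
  calc _ ≤ (C * q ^ k) * phiBound (max |x| |y|) k * phiBound (max |x| |y|) k := by
        gcongr
        · exact hC k
        · exact h1
        · exact h2
    _ = _ := by ring

lemma summable_norm_eigenvalue_mul_phi (hq0 : 0 < q) (hq1 : q < 1) (x : ℝ) :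
    Summable fun k => ‖eigenvalue q z k * (phi k x : ℂ)‖ := by
  obtain ⟨C, hC0, hC⟩ := exists_norm_eigenvalue_le hq0 hq1
  refine Summable.of_nonneg_of_le (fun _ => norm_nonneg _) (fun k => ?_)
    ((summable_phiBound_pow_mul hq0 hq1 (abs_nonneg x) 1).mul_left C)
  rw [norm_mul, Complex.norm_real]
  have h1 := abs_phi_le_phiBound (le_refl |x|) k
  calc _ ≤ (C * q ^ k) * phiBound |x| k := by
        gcongr
        · exact hC k
        · exact h1
    _ = _ := by ring

lemma summable_norm_eigenvalue (hq0 : 0 < q) (hq1 : q < 1) : Summable fun k => ‖eigenvalue q z k‖ := by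
  obtain ⟨C, hC0, hC⟩ := exists_norm_eigenvalue_le hq0 hq1
  exact Summable.of_nonneg_of_le (fun _ => norm_nonneg _) hC
    ((summable_geometric_of_lt_one hq0.le hq1).mul_left C)

lemma isIntegralOperator_kernel (hq0 : 0 < q) (hq1 : q < 1) (T : L2R →L[ℂ] L2R)
    (hT : ∀ f, HasSum (fun k => (eigenvalue q z k * inner ℂ (phiL k) f) • phiL k) (T f)) :
    IsIntegralOperator (kernel q z) T :=
  isIntegralOperator_diagonal (fun _ _ => rfl) (summable_norm_eigenvalue_mul_phi hq0 hq1)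
    (fun x y => (summable_norm_eigenvalue_mul hq0 hq1 x y).of_norm) T hT

lemma exists_isIntegralOperator_kernel (hq0 : 0 < q) (hq1 : q < 1) :
    ∃ T, IsIntegralOperator (kernel q z) T := by
  obtain ⟨T, hT⟩ := exists_hasSum_diagonal _ (summable_norm_eigenvalue hq0 hq1)
  exact ⟨T, isIntegralOperator_kernel hq0 hq1 T hT⟩

lemma isIntegralOperator_opK (hq0 : 0 < q) (hq1 : q < 1) : IsIntegralOperator (kernel q z) (opK q z) := by
  have h := exists_isIntegralOperator_kernel (z := z) hq0 hq1
  rw [opK, integralOperator, dif_pos h]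
  exact h.choose_spec

lemma hasSum_opK (hq0 : 0 < q) (hq1 : q < 1) (f : L2R) :
    HasSum (fun k => (eigenvalue q z k * inner ℂ (phiL k) f) • phiL k) (opK q z f) := by
  obtain ⟨T, hT⟩ := exists_hasSum_diagonal _ (summable_norm_eigenvalue hq0 hq1)
  rw [(isIntegralOperator_opK hq0 hq1).unique (isIntegralOperator_kernel hq0 hq1 T hT)]
  exact hT f

lemma chi_ae (B : Set ℝ) (hB : MeasurableSet B) (f : L2R) :
    chi B hB f =ᵐ[volume] B.indicator f :=
  ((Lp.memLp f).indicator hB).coeFn_toLp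

lemma norm_chi_le (B : Set ℝ) (hB : MeasurableSet B) (f : L2R) : ‖chi B hB f‖ ≤ ‖f‖ := by
  apply Lp.norm_le_norm_of_ae_le
  filter_upwards [chi_ae B hB f] with x hx
  rw [hx]
  exact norm_indicator_le_norm_self _ _

lemma inner_chi_left (B : Set ℝ) (hB : MeasurableSet B) (f g : L2R) :
    inner ℂ (chi B hB f) g = inner ℂ f (chi B hB g) := by
  rw [L2.inner_def, L2.inner_def]
  refine integral_congr_ae ?_
  filter_upwards [chi_ae B hB f, chi_ae B hB g] with x h1 h2
  rw [h1, h2]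
  by_cases h : x ∈ B <;> simp [h]

/-- The overlap matrix `∫_B φ_j φ_k`. -/
def overlap (B : Set ℝ) : Matrix ℕ ℕ ℝ := Matrix.of fun j k => ∫ x in B, phi j x * phi k x

lemma inner_phiL_chi (B : Set ℝ) (hB : MeasurableSet B) (j k : ℕ) :
    inner ℂ (phiL j) (chi B hB (phiL k)) = (overlap B j k : ℂ) := by
  have h : ∫ x, (phi j x : ℂ) * chi B hB (phiL k) x =
      ∫ x in B, ((phi j x * phi k x : ℝ) : ℂ) := by
    rw [← integral_indicator hB]
    refine integral_congr_ae ?_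
    filter_upwards [chi_ae B hB (phiL k), phiL_ae k] with x h1 h2
    rw [h1]
    by_cases h : x ∈ B <;> simp [h, h2]
  rw [inner_phiL_left, h, integral_complex_ofReal]
  rfl

lemma abs_overlap_le_one (B : Set ℝ) (hB : MeasurableSet B) (j k : ℕ) : |overlap B j k| ≤ 1 := by
  have h := norm_inner_phiL_le j (chi B hB (phiL k))
  rw [inner_phiL_chi, Complex.norm_real] at h
  exact h.trans ((norm_chi_le B hB _).trans (norm_phiL k).le)

lemma overlap_compl (A : Set ℝ) (hA : MeasurableSet A) (j k : ℕ) :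
    overlap A j k = (if j = k then 1 else 0) - overlap Aᶜ j k := by
  have := integral_add_compl hA (integrable_phi_mul_phi j k)
  rw [integral_phi_mul_phi] at this
  simp only [overlap, Matrix.of_apply]
  linarith

/-- The Fredholm determinant of `I - 𝐊(z; q) χ_B` as a series of principal minors. -/
lemma hasFredholmDet_oneSubK (hq0 : 0 < q) (hq1 : q < 1) (B : Set ℝ) (hB : MeasurableSet B) :
    HasFredholmDet (oneSubK q z B hB) (∑' S : Finset ℕ, (∏ i ∈ S, -eigenvalue q z i) *
      principalMinor ((overlap B).map Complex.ofReal) S) := by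
  obtain ⟨C, hC0, hC⟩ := exists_norm_eigenvalue_le hq0 hq1
  -- The projection is moved onto the left vectors, leaving `v_k = φ_k`. The conjugate compensates
  -- for the inner product being conjugate-linear in its first slot.
  have h := hasFredholmDet_of_hasSum
    (fun k => (starRingEnd ℂ) (-eigenvalue q z k) • chi B hB (phiL k)) phiL
    (fun k => C * q ^ k) (fun k => ?_) (fun k => (norm_phiL k).le) ?_ (oneSubK q z B hB)
    (fun f => ?_)
  · convert h using 3 with S
    rw [← principalMinor_row_mul]
    congr 1
    ext j k
    simp only [Matrix.of_apply, inner_smul_left, RingHomCompTriple.comp_apply, RingHom.id_apply,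
      inner_chi_left, inner_phiL_chi, Matrix.map_apply]
  · rw [norm_smul, RCLike.norm_conj, norm_neg]
    calc _ ≤ (C * q ^ k) * 1 := by
          gcongr
          · exact hC k
          · exact (norm_chi_le B hB _).trans (norm_phiL k).le
      _ = _ := mul_one _
  · refine ((summable_succ_mul_geometric hq0 hq1).mul_left C).congr fun k => ?_
    ring
  · have h1 := (hasSum_opK (z := z) hq0 hq1 (chi B hB f)).neg
    have h2 : oneSubK q z B hB f - f = -opK q z (chi B hB f) := by
      simp [oneSubK]
    rw [h2]
    refine h1.congr_fun fun k => ?_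
    rw [inner_smul_left, inner_chi_left]
    simp

lemma fredholmDet_oneSubK (hq0 : 0 < q) (hq1 : q < 1) (B : Set ℝ) (hB : MeasurableSet B) :
    fredholmDet (oneSubK q z B hB) = ∑' S : Finset ℕ, (∏ i ∈ S, -eigenvalue q z i) *
      principalMinor ((overlap B).map Complex.ofReal) S :=
  (hasFredholmDet_oneSubK hq0 hq1 B hB).2.limUnder_eq

end Operator

/-! ### Extraction of a coefficient by a circle integral -/

section Contour

/-- On the circle `G` is an absolutely convergent series in the powers `z ^ (S.card - n - 1)`.
Integrating termwise keeps only the exponent `-1`. Nothing is assumed about `G` off the circle, so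
poles inside it are harmless. -/
lemma circle_coefficient (n : ℕ) {r : ℝ} (hr : 0 < r) (c : Finset ℕ → ℂ)
    (hs : Summable fun S : Finset ℕ => r ^ S.card * ‖c S‖) (a : ℂ) (G : ℂ → ℂ)
    (hG : ∀ z, ‖z‖ = r → G z = a * ((∑' S : Finset ℕ, z ^ S.card * c S) / z ^ n) / z) :
    CircleIntegrable G 0 r ∧
      1 / (2 * (Real.pi : ℂ) * Complex.I) * ∮ z in C(0, r), G z =
        a * ∑' S : Finset ℕ, if S.card = n then c S else 0 := by
  let T : Finset ℕ → ℂ → ℂ := fun S z => (a * c S) * (z - 0) ^ ((S.card : ℤ) - n - 1)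
  let u : Finset ℕ → ℝ := fun S => (‖a‖ * r ^ (-(n : ℤ) - 1)) * (r ^ S.card * ‖c S‖)
  have hu : Summable u := hs.mul_left _
  have hne : ∀ z : ℂ, ‖z‖ = r → z ≠ 0 := fun z hz h => by simp [h] at hz; linarith
  have hTu : ∀ S z, ‖z‖ = r → ‖T S z‖ = u S := by
    intro S z hz
    simp only [T, u, sub_zero, norm_mul, norm_zpow, hz]
    rw [show (S.card : ℤ) - n - 1 = S.card + (-(n : ℤ) - 1) by ring, zpow_add₀ hr.ne',
      zpow_natCast]
    ring
  have hGT : ∀ z, ‖z‖ = r → HasSum (fun S => T S z) (G z) := by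
    intro z hz
    have hz0 := hne z hz
    have h1 : ∀ S : Finset ℕ, T S z = a / z ^ n / z * (z ^ S.card * c S) := by
      intro S
      simp only [T, sub_zero]
      rw [zpow_sub₀ hz0, zpow_sub₀ hz0, zpow_natCast, zpow_natCast, zpow_one]
      field_simp
    have h2 : Summable fun S : Finset ℕ => z ^ S.card * c S := by
      refine Summable.of_norm (hs.congr fun S => ?_)
      rw [norm_mul, norm_pow, hz]
    have h3 : G z = a / z ^ n / z * ∑' S : Finset ℕ, z ^ S.card * c S := by
      rw [hG z hz]
      field_simp
    rw [h3]
    exact (h2.hasSum.mul_left (a / z ^ n / z)).congr_fun h1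
  have hsph : ∀ z ∈ Metric.sphere (0 : ℂ) r, ‖z‖ = r := fun z hz => by simpa using hz
  have hTc : ∀ S, ContinuousOn (T S) (Metric.sphere 0 r) := by
    intro S
    refine continuousOn_const.mul (ContinuousOn.zpow₀ (by fun_prop) _ fun z hz => Or.inl ?_)
    simpa using hne z (hsph z hz)
  have hcont : ContinuousOn G (Metric.sphere 0 r) := by
    refine (continuousOn_tsum hTc hu fun S z hz => (hTu S z (hsph z hz)).le).congr fun z hz => ?_
    exact (hGT z (hsph z hz)).tsum_eq.symm
  refine ⟨hcont.circleIntegrable hr.le, ?_⟩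
  have hcm : ∀ θ : ℝ, ‖circleMap 0 r θ‖ = r := fun θ => by simp [abs_of_pos hr]
  have hsum : HasSum (fun S => ∮ z in C(0, r), T S z) (∮ z in C(0, r), G z) := by
    refine intervalIntegral.hasSum_integral_of_dominated_convergence
      (fun S _ => r * u S) (fun S => ?_) (fun S => ?_) ?_ ?_ ?_
    · refine Continuous.aestronglyMeasurable ?_
      have h1 : Continuous fun θ => deriv (circleMap 0 r) θ := by
        simp only [deriv_circleMap]
        fun_prop
      exact h1.smul ((hTc S).comp_continuous (continuous_circleMap 0 r)
        fun θ => circleMap_mem_sphere 0 hr.le θ)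
    · refine Eventually.of_forall fun θ _ => ?_
      rw [norm_smul, deriv_circleMap, norm_mul, Complex.norm_I, mul_one, hcm, hTu _ _ (hcm θ)]
    · exact Eventually.of_forall fun θ _ => hu.mul_left r
    · exact intervalIntegrable_const
    · exact Eventually.of_forall fun θ _ => (hGT _ (hcm θ)).const_smul _
  have hT : ∀ S : Finset ℕ, (∮ z in C(0, r), T S z) =
      (2 * (Real.pi : ℂ) * Complex.I) * (a * if S.card = n then c S else 0) := by
    intro S
    have h1 : (∮ z in C(0, r), T S z) =
        (a * c S) * ∮ z in C(0, r), (z - 0) ^ ((S.card : ℤ) - n - 1) :=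
      circleIntegral.integral_const_mul _ _ _ _
    rw [h1]
    split_ifs with h
    · have h2 : (S.card : ℤ) - n - 1 = -1 := by omega
      simp_rw [h2, zpow_neg_one]
      rw [circleIntegral.integral_sub_center_inv _ hr.ne']
      ring
    · have h2 : (S.card : ℤ) - n - 1 ≠ -1 := by omega
      rw [circleIntegral.integral_sub_zpow_of_ne h2]
      simp
  rw [← hsum.tsum_eq]
  simp_rw [hT]
  rw [tsum_mul_left, tsum_mul_left, one_div, inv_mul_cancel_left₀]
  exact Complex.two_pi_I_ne_zero

end Contour

/-! ### Occupied levels, the partition function and canonical averages -/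

section States

/-- The set of occupied levels of a state. -/
def occupied {n : ℕ} (k : State n) : Finset ℕ :=
  Finset.univ.map ⟨k.1, k.2.injective⟩

lemma card_occupied {n : ℕ} (k : State n) : (occupied k).card = n := by simp [occupied]

lemma prod_occupied {n : ℕ} (k : State n) (f : ℕ → ℝ) : ∏ i ∈ occupied k, f i = ∏ i, f (k.1 i) := by
  simp [occupied]

lemma sum_occupied {n : ℕ} {M : Type*} [AddCommMonoid M] (k : State n) (f : ℕ → M) :
    ∑ i ∈ occupied k, f i = ∑ i, f (k.1 i) := by
  simp [occupied]

lemma occupied_injective (n : ℕ) : Function.Injective (occupied (n := n)) := by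
  intro k l h
  apply Subtype.ext
  refine (StrictMono.range_inj k.2 l.2).1 ?_
  have := congrArg (fun S : Finset ℕ => (S : Set ℕ)) h
  simpa [occupied] using this

lemma mem_range_occupied {n : ℕ} {S : Finset ℕ} (hS : S.card = n) :
    S ∈ Set.range (occupied (n := n)) := by
  refine ⟨⟨S.orderEmbOfFin hS, (S.orderEmbOfFin hS).strictMono⟩, ?_⟩
  apply Finset.coe_injective
  simp [occupied]

lemma tsum_state {n : ℕ} {E : Type*} [AddCommGroup E] [TopologicalSpace E] [T2Space E]
    (f : Finset ℕ → E) :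
    ∑' k : State n, f (occupied k) = ∑' S : Finset ℕ, if S.card = n then f S else 0 := by
  rw [← (occupied_injective n).tsum_eq]
  · exact tsum_congr fun k => by rw [if_pos (card_occupied k)]
  · intro S hS
    refine mem_range_occupied ?_
    by_contra h
    simp [h] at hS

variable {q : ℝ}

lemma summable_prod_pow (hq0 : 0 < q) (hq1 : q < 1) :
    Summable fun S : Finset ℕ => ∏ i ∈ S, q ^ i :=
  summable_finsetProd_of_summable_nonneg (fun i => pow_nonneg hq0.le i)
    (summable_geometric_of_lt_one hq0.le hq1)

/-- The `n`-th elementary symmetric function of `1, q, q², …`. -/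
def elemSymm (n : ℕ) (q : ℝ) : ℝ := ∑' S : Finset ℕ, if S.card = n then ∏ i ∈ S, q ^ i else 0

lemma summable_elemSymm (hq0 : 0 < q) (hq1 : q < 1) (n : ℕ) :
    Summable fun S : Finset ℕ => if S.card = n then ∏ i ∈ S, q ^ i else 0 := by
  refine Summable.of_norm_bounded (summable_prod_pow hq0 hq1) fun S => ?_
  have h : 0 ≤ ∏ i ∈ S, q ^ i := Finset.prod_nonneg fun i _ => pow_nonneg hq0.le i
  split_ifs
  · rw [Real.norm_of_nonneg h]
  · simpa using h

lemma elemSymm_zero : elemSymm 0 q = 1 := by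
  rw [elemSymm, tsum_eq_single ∅]
  · simp
  · intro S hS
    simp [hS]

lemma prod_pow_map_succ (S : Finset ℕ) :
    ∏ i ∈ S.map ⟨Nat.succ, Nat.succ_injective⟩, q ^ i = q ^ S.card * ∏ i ∈ S, q ^ i := by
  simp [Finset.prod_map, pow_succ, Finset.prod_mul_distrib, mul_comm]

/-- Sets of `n + 1` levels are split according to whether they contain `0`. Those without `0` are
shifts of sets of the same size (factor `q ^ (n + 1)`); the others are `0` together with a shifted
set of size `n` (factor `q ^ n`). -/
lemma elemSymm_succ (hq0 : 0 < q) (hq1 : q < 1) (n : ℕ) :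
    elemSymm (n + 1) q * (1 - q ^ (n + 1)) = q ^ n * elemSymm n q := by
  let g : ℕ → Finset ℕ → ℝ := fun n S => if S.card = n then ∏ i ∈ S, q ^ i else 0
  let s : Finset ℕ → Finset ℕ := fun S => S.map ⟨Nat.succ, Nat.succ_injective⟩
  have hs : Function.Injective s := Finset.map_injective _
  have hs0 : ∀ S, 0 ∉ s S := fun S => by simp [s]
  let t : Finset ℕ → Finset ℕ := fun S => insert 0 (s S)
  have ht : Function.Injective t := fun S S' h => hs <| by
    rw [← Finset.erase_insert (hs0 S), ← Finset.erase_insert (hs0 S')]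
    exact congrArg (fun A => A.erase 0) h
  have hsr : ∀ S : Finset ℕ, 0 ∉ S → S ∈ Set.range s := by
    intro S hS
    refine ⟨S.image Nat.pred, ?_⟩
    ext x
    simp only [s, Finset.mem_map, Finset.mem_image, Function.Embedding.coeFn_mk]
    constructor
    · rintro ⟨_, ⟨y, hy, rfl⟩, rfl⟩
      have : y ≠ 0 := fun h => hS (h ▸ hy)
      rwa [Nat.succ_pred this]
    · intro hx
      have : x ≠ 0 := fun h => hS (h ▸ hx)
      exact ⟨x.pred, ⟨x, hx, rfl⟩, Nat.succ_pred this⟩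
  have htr : ∀ S : Finset ℕ, 0 ∈ S → S ∈ Set.range t := by
    intro S hS
    obtain ⟨S', h⟩ := hsr (S.erase 0) (Finset.notMem_erase 0 S)
    exact ⟨S', by simp only [t, h, Finset.insert_erase hS]⟩
  have hg := summable_elemSymm hq0 hq1 (n + 1)
  have h1 : elemSymm (n + 1) q = ∑' S, (if 0 ∈ S then 0 else g (n + 1) S) +
      ∑' S, (if 0 ∈ S then g (n + 1) S else 0) := by
    rw [← Summable.tsum_add]
    · exact tsum_congr fun S => by by_cases h : 0 ∈ S <;> simp [h, g]
    · refine Summable.of_norm_bounded hg.norm fun S => ?_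
      by_cases h : 0 ∈ S <;> simp only [h, if_true, if_false, norm_zero, norm_nonneg, le_refl, g]
    · refine Summable.of_norm_bounded hg.norm fun S => ?_
      by_cases h : 0 ∈ S <;> simp only [h, if_true, if_false, norm_zero, norm_nonneg, le_refl, g]
  have h2 : ∑' S, (if 0 ∈ S then 0 else g (n + 1) S) = q ^ (n + 1) * elemSymm (n + 1) q := by
    rw [← hs.tsum_eq, elemSymm, ← tsum_mul_left]
    · refine tsum_congr fun S => ?_
      rw [if_neg (hs0 S)]
      simp only [g, s, Finset.card_map, prod_pow_map_succ]
      split_ifs with h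
      · rw [h]
      · simp
    · intro S hS
      refine hsr S fun h => ?_
      simp [h] at hS
  have h3 : ∑' S, (if 0 ∈ S then g (n + 1) S else 0) = q ^ n * elemSymm n q := by
    rw [← ht.tsum_eq, elemSymm, ← tsum_mul_left]
    · refine tsum_congr fun S => ?_
      rw [if_pos (Finset.mem_insert_self _ _)]
      simp only [g, t, Finset.card_insert_of_notMem (hs0 S), Finset.prod_insert (hs0 S)]
      simp only [s, Finset.card_map, prod_pow_map_succ, add_left_inj, pow_zero, one_mul]
      split_ifs with h
      · rw [h]
      · simp
    · intro S hS
      refine htr S ?_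
      by_contra h
      simp [h] at hS
  rw [h2, h3] at h1
  linarith

lemma elemSymm_mul_prod (hq0 : 0 < q) (hq1 : q < 1) (n : ℕ) :
    elemSymm n q * ∏ k ∈ Finset.range n, (1 - q * q ^ k) =
      q ^ ((n : ℝ) * ((n : ℝ) - 1) / 2) := by
  induction n with
  | zero => simp [elemSymm_zero]
  | succ n ih =>
    rw [Finset.prod_range_succ, mul_comm (∏ k ∈ Finset.range n, _), ← mul_assoc, ← pow_succ',
      elemSymm_succ hq0 hq1, mul_assoc, ih, ← Real.rpow_natCast, ← Real.rpow_add hq0]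
    congr 1
    push_cast
    ring

lemma weight_eq (hq0 : 0 < q) {n : ℕ} (k : State n) :
    weight n q k.1 = q ^ ((n : ℝ) / 2) * ∏ i ∈ occupied k, q ^ i := by
  rw [weight, Real.rpow_add hq0, mul_comm, prod_occupied, ← Nat.cast_sum, Real.rpow_natCast,
    Finset.prod_pow_eq_pow_sum]

lemma partitionFunction_eq (hq0 : 0 < q) (n : ℕ) :
    partitionFunction n q = q ^ ((n : ℝ) / 2) * elemSymm n q := by
  rw [partitionFunction]
  simp_rw [weight_eq hq0]
  rw [tsum_mul_left, tsum_state (fun S => ∏ i ∈ S, q ^ i), elemSymm]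

lemma elemSymm_pos (hq0 : 0 < q) (hq1 : q < 1) (n : ℕ) : 0 < elemSymm n q := by
  have h := elemSymm_mul_prod hq0 hq1 n
  have h1 : 0 < ∏ k ∈ Finset.range n, (1 - q * q ^ k) := by
    refine Finset.prod_pos fun k _ => ?_
    rw [← pow_succ', sub_pos]
    exact pow_lt_one₀ hq0.le hq1 (Nat.succ_ne_zero k)
  refine pos_of_mul_pos_left ?_ h1.le
  rw [h]
  positivity

lemma partitionFunction_pos (hq0 : 0 < q) (hq1 : q < 1) (n : ℕ) : 0 < partitionFunction n q := by
  rw [partitionFunction_eq hq0]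
  exact mul_pos (by positivity) (elemSymm_pos hq0 hq1 n)

/-- The canonical average of the observable `c` of the set of occupied levels. -/
def canonicalMean (n : ℕ) (q : ℝ) (c : Finset ℕ → ℝ) : ℝ :=
  1 / partitionFunction n q * ∑' k : State n, weight n q k.1 * c (occupied k)

/-- The zero-point factor `q ^ (n / 2)` cancels against the partition function, leaving the constant
prefactor of `F`. -/
lemma canonicalMean_eq (hq0 : 0 < q) (hq1 : q < 1) (n : ℕ) (c : Finset ℕ → ℝ) :
    canonicalMean n q c = (q ^ (-((n : ℝ) * ((n : ℝ) - 1) / 2)) *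
      ∏ k ∈ Finset.range n, (1 - q * q ^ k)) *
        ∑' S : Finset ℕ, if S.card = n then (∏ i ∈ S, q ^ i) * c S else 0 := by
  rw [canonicalMean, partitionFunction_eq hq0]
  simp_rw [weight_eq hq0, mul_assoc]
  rw [tsum_mul_left, tsum_state (fun S => (∏ i ∈ S, q ^ i) * c S), Real.rpow_neg hq0.le,
    ← elemSymm_mul_prod hq0 hq1 n]
  have h1 := (elemSymm_pos hq0 hq1 n).ne'
  have h2 : q ^ ((n : ℝ) / 2) ≠ 0 := by positivity
  have h3 : ∏ k ∈ Finset.range n, (1 - q * q ^ k) ≠ 0 := by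
    intro h
    have := elemSymm_mul_prod hq0 hq1 n
    rw [h, mul_zero] at this
    have h4 : 0 < q ^ ((n : ℝ) * ((n : ℝ) - 1) / 2) := by positivity
    exact h4.ne this
  field_simp

/-- Passing from the grand canonical generating function to the canonical average by a contour
integral. -/
lemma circleIntegral_eq_canonicalMean (hq0 : 0 < q) (hq1 : q < 1) (n : ℕ) {r : ℝ} (hr : 0 < r)
    (c : Finset ℕ → ℝ)
    (hs : Summable fun S : Finset ℕ => r ^ S.card * |(∏ i ∈ S, q ^ i) * c S|) (D : ℂ → ℂ)
    (hD : ∀ z : ℂ, ‖z‖ = r → qPochInf (-z) q * D z =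
      ∑' S : Finset ℕ, (∏ i ∈ S, (q : ℂ) ^ i * z) * (c S : ℂ)) :
    CircleIntegrable (fun z => F n q z * D z / z) 0 r ∧
      ((canonicalMean n q c : ℝ) : ℂ) =
        1 / (2 * (Real.pi : ℂ) * Complex.I) * ∮ z in C(0, r), F n q z * D z / z := by
  have h := circle_coefficient n hr (fun S => (((∏ i ∈ S, q ^ i) * c S : ℝ) : ℂ))
    (by simpa only [Complex.norm_real, Real.norm_eq_abs] using hs)
    (((q ^ (-((n : ℝ) * ((n : ℝ) - 1) / 2)) : ℝ) : ℂ) * qPoch q q n)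
    (fun z => F n q z * D z / z) (fun z hz => ?_)
  · refine ⟨h.1, ?_⟩
    rw [h.2, canonicalMean_eq hq0 hq1]
    push_cast
    rw [qPoch]
    congr 2
    ext S
    split_ifs <;> simp
  · have h1 : ∑' S : Finset ℕ, z ^ S.card * (((∏ i ∈ S, q ^ i) * c S : ℝ) : ℂ) =
        qPochInf (-z) q * D z := by
      rw [hD z hz]
      refine tsum_congr fun S => ?_
      rw [Finset.prod_mul_distrib, Finset.prod_const]
      push_cast
      ring
    rw [h1, F]
    ring

end States

/-! ### Grand canonical generating functions of the two observables -/

section GeneratingFunctions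

lemma det_map_ofReal {κ : Type*} [Fintype κ] [DecidableEq κ] (M : Matrix κ κ ℝ) :
    (M.map Complex.ofReal).det = ((M.det : ℝ) : ℂ) :=
  (RingHom.map_det Complex.ofRealHom M).symm

lemma principalMinor_map_ofReal {ι : Type*} (M : Matrix ι ι ℝ) (S : Finset ι) [DecidableEq ι] :
    principalMinor (M.map Complex.ofReal) S = ((principalMinor M S : ℝ) : ℂ) :=
  det_map_ofReal (M.submatrix (Subtype.val : S → ι) (Subtype.val : S → ι))

variable {q : ℝ}

lemma one_add_pow_mul_ne_zero (hq0 : 0 < q) {r : ℝ} (hr : ∀ k : ℕ, q ^ k * r ≠ 1) {z : ℂ}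
    (hz : ‖z‖ = r) (k : ℕ) : 1 + (q : ℂ) ^ k * z ≠ 0 := by
  intro h
  have h1 : (q : ℂ) ^ k * z = -1 := by linear_combination h
  have h2 := congrArg norm h1
  rw [norm_mul, norm_pow, Complex.norm_real, Real.norm_of_nonneg hq0.le, hz, norm_neg,
    norm_one] at h2
  exact hr k h2

lemma multipliable_one_add_pow_mul (hq0 : 0 < q) (hq1 : q < 1) (z : ℂ) :
    Multipliable fun i : ℕ => 1 + (q : ℂ) ^ i * z := by
  refine multipliable_one_add_of_summable_prod (summable_finsetProd_of_summable_norm ?_)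
  refine ((summable_geometric_of_lt_one hq0.le hq1).mul_right ‖z‖).congr fun i => ?_
  rw [norm_mul, norm_pow, Complex.norm_real, Real.norm_of_nonneg hq0.le]

lemma qPochInf_neg (z : ℂ) : qPochInf (-z) q = ∏' i : ℕ, (1 + (q : ℂ) ^ i * z) := by
  rw [qPochInf]
  congr 1
  ext i
  ring

lemma norm_prod_pow_mul (hq0 : 0 < q) (z : ℂ) (S : Finset ℕ) :
    ‖∏ i ∈ S, (q : ℂ) ^ i * z‖ = ∏ i ∈ S, (q ^ i * ‖z‖) := by
  rw [norm_prod]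
  refine Finset.prod_congr rfl fun i _ => ?_
  rw [norm_mul, norm_pow, Complex.norm_real, Real.norm_of_nonneg hq0.le]

lemma pow_card_mul_abs (hq0 : 0 < q) (r : ℝ) (S : Finset ℕ) (c : ℝ) :
    r ^ S.card * |(∏ i ∈ S, q ^ i) * c| = (∏ i ∈ S, (q ^ i * r)) * |c| := by
  rw [abs_mul, abs_of_nonneg (Finset.prod_nonneg fun i _ => pow_nonneg hq0.le i),
    Finset.prod_mul_distrib, Finset.prod_const]
  ring

lemma abs_principalMinor_overlap_le {A : Set ℝ} (hA : MeasurableSet A) (S : Finset ℕ) :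
    |principalMinor (overlap A) S| ≤ ∏ i ∈ S, ((i : ℝ) + 1) := by
  have h := norm_principalMinor_le ((overlap A).map Complex.ofReal) S (fun _ => 1) fun i j => by
    rw [Matrix.map_apply, Complex.norm_real]
    exact abs_overlap_le_one A hA i j
  rw [principalMinor_map_ofReal, Complex.norm_real] at h
  simpa using h

lemma summable_principalMinor_overlap (hq0 : 0 < q) (hq1 : q < 1) {r : ℝ} (hr : 0 ≤ r) {A : Set ℝ}
    (hA : MeasurableSet A) :
    Summable fun S : Finset ℕ => (∏ i ∈ S, (q ^ i * r)) * |principalMinor (overlap A) S| := by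
  have h1 : Summable fun S : Finset ℕ => ∏ i ∈ S, (((i : ℝ) + 1) * q ^ i * r) :=
    summable_finsetProd_of_summable_nonneg (fun i => by positivity)
      ((summable_succ_mul_geometric hq0 hq1).mul_right r)
  refine Summable.of_nonneg_of_le (fun S => ?_) (fun S => ?_) h1
  · exact mul_nonneg (Finset.prod_nonneg fun i _ => by positivity) (abs_nonneg _)
  · refine (mul_le_mul_of_nonneg_left (abs_principalMinor_overlap_le hA S)
      (Finset.prod_nonneg fun i _ => by positivity)).trans (le_of_eq ?_)
    rw [← Finset.prod_mul_distrib]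
    exact Finset.prod_congr rfl fun i _ => by ring

/-- The gap identity with `N` the overlaps on the complement, so that `1 - N` is the overlap matrix
of `A` by orthonormality. -/
lemma gap_generating_function (hq0 : 0 < q) (hq1 : q < 1) {z : ℂ}
    (hz : ∀ k : ℕ, 1 + (q : ℂ) ^ k * z ≠ 0) {A : Set ℝ} (hA : MeasurableSet A) :
    qPochInf (-z) q * fredholmDet (oneSubK q z Aᶜ hA.compl) =
      ∑' S : Finset ℕ, (∏ i ∈ S, (q : ℂ) ^ i * z) * ((principalMinor (overlap A) S : ℝ) : ℂ) := by
  have h0 : (overlap A).map Complex.ofReal = 1 - (overlap Aᶜ).map Complex.ofReal := by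
    ext i j
    rw [Matrix.sub_apply, Matrix.map_apply, Matrix.map_apply, overlap_compl A hA,
      Matrix.one_apply]
    split_ifs <;> simp
  obtain ⟨C, hC0, hC⟩ := exists_norm_eigenvalue_le (z := z) hq0 hq1
  rw [fredholmDet_oneSubK hq0 hq1, qPochInf_neg]
  simp_rw [← principalMinor_map_ofReal, h0]
  refine tsum_principalMinor_gap hz _ ?_ ?_ (multipliable_one_add_pow_mul hq0 hq1 z)
  · refine Summable.of_norm_bounded
      (summable_principalMinor_overlap hq0 hq1 hC0 hA.compl) fun S => ?_
    rw [norm_mul, principalMinor_map_ofReal, Complex.norm_real, norm_prod]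
    refine mul_le_mul_of_nonneg_right ?_ (abs_nonneg _)
    refine Finset.prod_le_prod (fun _ _ => norm_nonneg _) fun i _ => ?_
    exact (norm_neg _).le.trans ((hC i).trans_eq (mul_comm _ _))
  · rw [← h0]
    refine Summable.of_norm_bounded
      (summable_principalMinor_overlap hq0 hq1 (norm_nonneg z) hA) fun S => ?_
    rw [norm_mul, principalMinor_map_ofReal, Complex.norm_real, norm_prod_pow_mul hq0]
    rfl

lemma gap_contour (hq0 : 0 < q) (hq1 : q < 1) (n : ℕ) {r : ℝ} (hr0 : 0 < r)
    (hr : ∀ k : ℕ, q ^ k * r ≠ 1) {A : Set ℝ} (hA : MeasurableSet A) :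
    CircleIntegrable (fun z => F n q z * fredholmDet (oneSubK q z Aᶜ hA.compl) / z) 0 r ∧
      ((canonicalMean n q (principalMinor (overlap A)) : ℝ) : ℂ) =
        1 / (2 * (Real.pi : ℂ) * Complex.I) *
          ∮ z in C(0, r), F n q z * fredholmDet (oneSubK q z Aᶜ hA.compl) / z := by
  refine circleIntegral_eq_canonicalMean hq0 hq1 n hr0 _ ?_ _ fun z hz =>
    gap_generating_function hq0 hq1 (one_add_pow_mul_ne_zero hq0 hr hz) hA
  simp_rw [pow_card_mul_abs hq0]
  exact summable_principalMinor_overlap hq0 hq1 hr0.le hA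

/-- The matrix `∑_{k ∈ S} φ_k(x_i) φ_k(x_j)`. -/
def projectionKernel {m : ℕ} (x : Fin m → ℝ) (S : Finset ℕ) : Matrix (Fin m) (Fin m) ℝ :=
  gram 1 (fun k i => phi k (x i)) S

lemma exists_abs_le {m : ℕ} (x : Fin m → ℝ) : ∃ R, 0 ≤ R ∧ ∀ i, |x i| ≤ R :=
  ⟨∑ i, |x i|, Finset.sum_nonneg fun _ _ => abs_nonneg _, fun i =>
    Finset.single_le_sum (f := fun i => |x i|) (fun _ _ => abs_nonneg _) (Finset.mem_univ i)⟩

lemma sum_le_prod_two_mul {ι : Type*} (S : Finset ι) (b : ι → ℝ) (hb : ∀ i, 1 ≤ b i) :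
    ∑ i ∈ S, b i ≤ ∏ i ∈ S, 2 * b i := by
  classical
  -- The extra `1` makes the induction close: `2b(s + 1) ≥ b + s + 1` for `b ≥ 1` and `s ≥ 0`.
  have h : (∑ i ∈ S, b i) + 1 ≤ ∏ i ∈ S, 2 * b i := by
    induction S using Finset.induction_on with
    | empty => simp
    | insert a S ha ih =>
      rw [Finset.sum_insert ha, Finset.prod_insert ha]
      have h1 : 0 ≤ ∑ i ∈ S, b i := Finset.sum_nonneg fun i _ => zero_le_one.trans (hb i)
      nlinarith [hb a]
  linarith

/-- The entries are sums over `S`; they are bounded by products over `S` so that the sum over all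
finite sets is controlled by a single series over levels. -/
lemma abs_det_projectionKernel_le {m : ℕ} {x : Fin m → ℝ} {R : ℝ} (hR : 0 ≤ R)
    (hx : ∀ i, |x i| ≤ R) (S : Finset ℕ) :
    |(projectionKernel x S).det| ≤ m.factorial * ∏ i ∈ S, (2 * phiBound R i ^ 2) ^ m := by
  have h := norm_det_le ((projectionKernel x S).map Complex.ofReal)
    (fun _ => ∏ i ∈ S, 2 * phiBound R i ^ 2) fun i j => by
      rw [Matrix.map_apply, Complex.norm_real]
      refine le_trans ?_ (sum_le_prod_two_mul S (fun i => phiBound R i ^ 2) fun i =>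
        one_le_pow₀ (one_le_phiBound hR i))
      refine (norm_sum_le _ _).trans (Finset.sum_le_sum fun k _ => ?_)
      rw [Pi.one_apply, one_mul, norm_mul, sq]
      exact mul_le_mul (abs_phi_le_phiBound (hx i) k) (abs_phi_le_phiBound (hx j) k)
        (norm_nonneg _) (phiBound_pos hR k).le
  rw [det_map_ofReal, Complex.norm_real] at h
  simpa [Finset.prod_pow] using h

lemma summable_det_projectionKernel (hq0 : 0 < q) (hq1 : q < 1) {r : ℝ} (hr : 0 ≤ r) {m : ℕ}
    (x : Fin m → ℝ) :
    Summable fun S : Finset ℕ => (∏ i ∈ S, (q ^ i * r)) * |(projectionKernel x S).det| := by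
  obtain ⟨R, hR, hx⟩ := exists_abs_le x
  have h1 : Summable fun S : Finset ℕ => ∏ i ∈ S, (2 ^ m * r) * (phiBound R i ^ (2 * m) * q ^ i) :=
    summable_finsetProd_of_summable_nonneg
      (fun i => by have := phiBound_pos hR i; positivity)
      ((summable_phiBound_pow_mul hq0 hq1 hR (2 * m)).mul_left _)
  refine Summable.of_nonneg_of_le (fun S => ?_) (fun S => ?_) (h1.mul_left (m.factorial : ℝ))
  · exact mul_nonneg (Finset.prod_nonneg fun i _ => by positivity) (abs_nonneg _)
  · refine (mul_le_mul_of_nonneg_left (abs_det_projectionKernel_le hR hx S)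
      (Finset.prod_nonneg fun i _ => by positivity)).trans (le_of_eq ?_)
    rw [mul_left_comm, ← Finset.prod_mul_distrib]
    congr 1
    refine Finset.prod_congr rfl fun i _ => ?_
    rw [mul_pow, ← pow_mul]
    ring

lemma gram_one_ofReal {m : ℕ} (x : Fin m → ℝ) (S : Finset ℕ) :
    gram 1 (fun k i => (phi k (x i) : ℂ)) S = (projectionKernel x S).map Complex.ofReal := by
  ext i j
  simp [gram, projectionKernel]

lemma kernel_generating_function (hq0 : 0 < q) (hq1 : q < 1) {z : ℂ}
    (hz : ∀ k : ℕ, 1 + (q : ℂ) ^ k * z ≠ 0) {m : ℕ} (x : Fin m → ℝ) :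
    qPochInf (-z) q * (Matrix.of fun i j : Fin m => kernel q z (x i) (x j)).det =
      ∑' S : Finset ℕ, (∏ i ∈ S, (q : ℂ) ^ i * z) * (((projectionKernel x S).det : ℝ) : ℂ) := by
  rw [qPochInf_neg]
  simp_rw [← det_map_ofReal, ← gram_one_ofReal]
  refine tprod_one_add_mul_det (w := fun i => (q : ℂ) ^ i * z) hz
    (fun k i => (phi k (x i) : ℂ))
    (fun i j => (summable_norm_eigenvalue_mul hq0 hq1 (x i) (x j)).of_norm) ?_
    (multipliable_one_add_pow_mul hq0 hq1 z)
  refine Summable.of_norm_bounded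
    (summable_det_projectionKernel hq0 hq1 (norm_nonneg z) x) fun S => ?_
  rw [norm_mul, gram_one_ofReal, det_map_ofReal, Complex.norm_real, norm_prod_pow_mul hq0]
  rfl

lemma kernel_contour (hq0 : 0 < q) (hq1 : q < 1) (n : ℕ) {r : ℝ} (hr0 : 0 < r)
    (hr : ∀ k : ℕ, q ^ k * r ≠ 1) {m : ℕ} (x : Fin m → ℝ) :
    CircleIntegrable (fun z => F n q z *
        (Matrix.of fun i j : Fin m => kernel q z (x i) (x j)).det / z) 0 r ∧
      ((canonicalMean n q (fun S => (projectionKernel x S).det) : ℝ) : ℂ) =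
        1 / (2 * (Real.pi : ℂ) * Complex.I) *
          ∮ z in C(0, r), F n q z *
            (Matrix.of fun i j : Fin m => kernel q z (x i) (x j)).det / z := by
  refine circleIntegral_eq_canonicalMean hq0 hq1 n hr0 _ ?_ _ fun z hz =>
    kernel_generating_function hq0 hq1 (one_add_pow_mul_ne_zero hq0 hr hz) x
  simp_rw [pow_card_mul_abs hq0]
  exact summable_det_projectionKernel hq0 hq1 hr0.le x

end GeneratingFunctions

/-! ### Double sums over permutations and mixed discriminants -/

section PermutationSums

open Equiv.Perm (sign)

/-- Left multiplication by a permutation extending `f i ↦ e i` matches the fibres of `σ ↦ σ ∘ f`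
over `f` and over `e`. All fibres thus have the same size, which counting the `n!` permutations
shows to be `(n - m)!`. -/
lemma sum_perm_comp_embedding {m n : ℕ} (f : Fin m ↪ Fin n) (h : (Fin m → Fin n) → ℝ)
    (hh : ∀ g, ¬ Function.Injective g → h g = 0) :
    ∑ σ : Equiv.Perm (Fin n), h (σ ∘ f) = ((n - m).factorial : ℝ) * ∑ g, h g := by
  let T : Equiv.Perm (Fin n) → (Fin m ↪ Fin n) := fun σ => f.trans σ.toEmbedding
  let c : (Fin m ↪ Fin n) → ℕ := fun e => (Finset.univ.filter fun σ => T σ = e).card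
  have hmn : m ≤ n := by simpa using Fintype.card_le_of_embedding f
  have hc : ∀ e, c e = c f := by
    intro e
    obtain ⟨ρ, hρ⟩ := Equiv.Perm.exists_extending_pair f e f.injective e.injective
    refine (Finset.card_bij (fun σ _ => ρ * σ) ?_ (fun _ _ _ _ h => mul_left_cancel h) ?_).symm
    · intro σ hσ
      rw [Finset.mem_filter] at hσ ⊢
      refine ⟨Finset.mem_univ _, ?_⟩
      ext i
      have := DFunLike.congr_fun hσ.2 i
      simp only [T, Function.Embedding.trans_apply, Equiv.coe_toEmbedding] at this
      simp [T, this, hρ]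
    · intro σ hσ
      rw [Finset.mem_filter] at hσ
      refine ⟨ρ⁻¹ * σ, ?_, by simp⟩
      rw [Finset.mem_filter]
      refine ⟨Finset.mem_univ _, ?_⟩
      ext i
      have := DFunLike.congr_fun hσ.2 i
      simp only [T, Function.Embedding.trans_apply, Equiv.coe_toEmbedding] at this
      simp [T, this, ← hρ]
  have hcard : c f = (n - m).factorial := by
    have h1 : n.factorial = ∑ e, c e := by
      have := Finset.card_eq_sum_card_fiberwise (f := T) (s := Finset.univ) (t := Finset.univ)
        (fun _ _ => Finset.mem_coe.2 (Finset.mem_univ _))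
      rwa [Finset.card_univ, Fintype.card_perm, Fintype.card_fin] at this
    simp_rw [hc] at h1
    rw [Finset.sum_const, Finset.card_univ, Fintype.card_embedding_eq, Fintype.card_fin,
      Fintype.card_fin, smul_eq_mul, ← Nat.factorial_mul_descFactorial hmn, mul_comm] at h1
    exact (Nat.eq_of_mul_eq_mul_left (Nat.descFactorial_pos.2 hmn) h1).symm
  have h1 : ∑ σ : Equiv.Perm (Fin n), h (σ ∘ f) = ∑ e : Fin m ↪ Fin n, (c e : ℝ) * h e := by
    rw [← Finset.sum_fiberwise Finset.univ T]
    refine Finset.sum_congr rfl fun e _ => ?_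
    rw [Finset.sum_congr rfl (g := fun _ => h e), Finset.sum_const, nsmul_eq_mul]
    intro σ hσ
    rw [← (Finset.mem_filter.1 hσ).2]
    rfl
  have h2 : ∑ e : Fin m ↪ Fin n, h e = ∑ g, h g := by
    refine Finset.sum_of_injOn (fun e => (e : Fin m → Fin n)) (DFunLike.coe_injective.injOn)
      (fun _ _ => Finset.mem_coe.2 (Finset.mem_univ _)) (fun g _ hg => hh g fun hinj => hg ?_)
      (fun _ _ => rfl)
    exact ⟨⟨g, hinj⟩, Finset.mem_coe.2 (Finset.mem_univ _), rfl⟩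
  rw [h1, ← h2, Finset.mul_sum]
  simp_rw [hc, hcard]

/-- The sum `∑_{σ, τ} sgn(σ) sgn(τ) ∏_j G_j(σ(j), τ(j))`, a multiple of the mixed discriminant. -/
def permSum {n : ℕ} (G : Fin n → Matrix (Fin n) (Fin n) ℝ) : ℝ :=
  ∑ σ : Equiv.Perm (Fin n), ∑ τ : Equiv.Perm (Fin n),
    ((sign σ : ℤ) : ℝ) * ((sign τ : ℤ) : ℝ) * ∏ j, G j (σ j) (τ j)

lemma sign_mul_self {n : ℕ} (σ : Equiv.Perm (Fin n)) :
    ((sign σ : ℤ) : ℝ) * ((sign σ : ℤ) : ℝ) = 1 := by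
  rcases Int.units_eq_one_or (sign σ) with h | h <;> simp [h]

lemma permSum_rank_one {n : ℕ} (M : Matrix (Fin n) (Fin n) ℝ) :
    permSum (fun j => Matrix.of fun a b => M a j * M b j) = M.det ^ 2 := by
  rw [sq, Matrix.det_apply', Finset.sum_mul_sum, permSum]
  refine Finset.sum_congr rfl fun σ _ => Finset.sum_congr rfl fun τ _ => ?_
  simp only [Matrix.of_apply, Finset.prod_mul_distrib]
  ring

lemma permSum_const {n : ℕ} (G : Matrix (Fin n) (Fin n) ℝ) :
    permSum (fun _ => G) = (n.factorial : ℝ) * G.det := by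
  have h : ∀ σ : Equiv.Perm (Fin n), ∑ τ : Equiv.Perm (Fin n),
      ((sign σ : ℤ) : ℝ) * ((sign τ : ℤ) : ℝ) * ∏ j, G (σ j) (τ j) = G.det := by
    intro σ
    rw [← Matrix.det_transpose, Matrix.det_apply', ← Equiv.sum_comp (Equiv.mulRight σ)]
    refine Finset.sum_congr rfl fun τ _ => ?_
    rw [Equiv.coe_mulRight, Equiv.Perm.sign_mul]
    push_cast
    rw [mul_left_comm, sign_mul_self, mul_one]
    congr 1
    exact Equiv.prod_comp σ fun i => G i (τ i)
  rw [permSum, Finset.sum_congr rfl fun σ _ => h σ, Finset.sum_const, Finset.card_univ,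
    Fintype.card_perm, Fintype.card_fin, nsmul_eq_mul]

lemma det_of_not_injective {m n : ℕ} (v : Fin m → Fin n → ℝ) {g : Fin m → Fin n}
    (hg : ¬ Function.Injective g) : (Matrix.of fun i j : Fin m => v j (g i)).det = 0 := by
  rw [Function.Injective] at hg
  push Not at hg
  obtain ⟨a, b, hab, hne⟩ := hg
  refine Matrix.det_zero_of_row_eq hne ?_
  ext j
  simp [hab]

/-- Row multilinearity: the Cauchy–Binet expansion before grouping the injections by their image. -/
lemma det_sum_mul_eq_sum {m n : ℕ} (v : Fin m → Fin n → ℝ) :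
    (Matrix.of fun i j : Fin m => ∑ a, v i a * v j a).det =
      ∑ g : Fin m → Fin n, (∏ i, v i (g i)) * (Matrix.of fun i j : Fin m => v j (g i)).det := by
  have h1 := (Matrix.detRowAlternating : (Fin m → ℝ) [⋀^Fin m]→ₗ[ℝ] ℝ).toMultilinearMap.map_sum
    (fun (i : Fin m) (a : Fin n) => v i a • fun j => v j a)
  have h2 : (fun i : Fin m => ∑ a : Fin n, v i a • fun j => v j a) =
      Matrix.of fun i j : Fin m => ∑ a, v i a * v j a := by
    ext i j
    simp [Finset.sum_apply]
  rw [h2] at h1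
  refine h1.trans (Finset.sum_congr rfl fun g _ => ?_)
  rw [MultilinearMap.map_smul_univ]
  rfl

lemma det_sum_mul_eq_zero {m n : ℕ} (hnm : n < m) (v : Fin m → Fin n → ℝ) :
    (Matrix.of fun i j : Fin m => ∑ a, v i a * v j a).det = 0 := by
  rw [det_sum_mul_eq_sum]
  refine Finset.sum_eq_zero fun g _ => ?_
  rw [det_of_not_injective v, mul_zero]
  intro hg
  have := Fintype.card_le_of_injective g hg
  simp only [Fintype.card_fin] at this
  omega

/-- An identity matrix in slot `j` forces `τ j = σ j`, so `σ⁻¹ τ` is a permutation `π` of the range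
of `f`. The sum over `π` is an `m × m` determinant depending only on `σ ∘ f`, and each injection
arises from `(n - m)!` permutations `σ`. -/
lemma permSum_embedding {m n : ℕ} (f : Fin m ↪ Fin n) (v : Fin m → Fin n → ℝ)
    (G : Fin n → Matrix (Fin n) (Fin n) ℝ)
    (hG1 : ∀ i a b, G (f i) a b = v i a * v i b)
    (hG2 : ∀ j, j ∉ Set.range f → G j = 1) :
    permSum G = ((n - m).factorial : ℝ) *
      (Matrix.of fun i j : Fin m => ∑ a, v i a * v j a).det := by
  let h : (Fin m → Fin n) → ℝ := fun g =>
    (∏ i, v i (g i)) * (Matrix.of fun i j : Fin m => v j (g i)).det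
  have hh : ∀ g, ¬ Function.Injective g → h g = 0 := fun g hg => by
    simp only [h]
    rw [det_of_not_injective v hg, mul_zero]
  rw [det_sum_mul_eq_sum, ← sum_perm_comp_embedding f h hh, permSum]
  refine Finset.sum_congr rfl fun σ _ => ?_
  have hz : ∀ τ : Equiv.Perm (Fin n),
      τ ∉ (fun π : Equiv.Perm (Fin m) => σ * π.viaFintypeEmbedding f) ''
        ((Finset.univ : Finset (Equiv.Perm (Fin m))) : Set _) →
      ((sign σ : ℤ) : ℝ) * ((sign τ : ℤ) : ℝ) * ∏ j, G j (σ j) (τ j) = 0 := by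
    intro τ hτ
    by_contra hne
    apply hτ
    have hfix : ∀ j, j ∉ Set.range f → τ j = σ j := by
      intro j hj
      by_contra hj2
      apply hne
      rw [Finset.prod_eq_zero (Finset.mem_univ j), mul_zero]
      rw [hG2 j hj, Matrix.one_apply_ne (Ne.symm hj2)]
    have hfix' : ∀ j, j ∉ Set.range f → (σ⁻¹ * τ) j = j := by
      intro j hj
      simp [hfix j hj]
    have hmem : ∀ i, ∃ i', f i' = (σ⁻¹ * τ) (f i) := by
      intro i
      by_contra hi
      have h3 := hfix' _ hi
      have h4 : (σ⁻¹ * τ) (f i) = f i := (σ⁻¹ * τ).injective h3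
      exact hi ⟨i, h4.symm⟩
    choose p hp using hmem
    have hpinj : Function.Injective p := by
      intro a b hab
      have : (σ⁻¹ * τ) (f a) = (σ⁻¹ * τ) (f b) := by rw [← hp, ← hp, hab]
      exact f.injective ((σ⁻¹ * τ).injective this)
    obtain ⟨π, hπ⟩ : ∃ π : Equiv.Perm (Fin m), ∀ i, π i = p i :=
      ⟨Equiv.ofBijective p (Finite.injective_iff_bijective.1 hpinj), fun _ => rfl⟩
    refine ⟨π, Finset.mem_coe.2 (Finset.mem_univ _), ?_⟩
    have h5 : π.viaFintypeEmbedding f = σ⁻¹ * τ := by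
      ext j
      by_cases hj : j ∈ Set.range f
      · obtain ⟨i, rfl⟩ := hj
        rw [Equiv.Perm.viaFintypeEmbedding_apply_image, hπ, hp]
      · rw [Equiv.Perm.viaFintypeEmbedding_apply_notMem_range _ _ hj, hfix' j hj]
    simp only [h5, mul_inv_cancel_left]
  simp only [h]
  rw [Matrix.det_apply', Finset.mul_sum]
  symm
  refine Finset.sum_of_injOn (fun π : Equiv.Perm (Fin m) => σ * π.viaFintypeEmbedding f)
    ?_ (fun _ _ => Finset.mem_coe.2 (Finset.mem_univ _)) (fun τ _ hτ => hz τ hτ) ?_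
  · intro π _ π' _ hππ
    have h6 : π.viaFintypeEmbedding f = π'.viaFintypeEmbedding f := mul_left_cancel hππ
    ext i
    have h7 := Equiv.congr_fun h6 (f i)
    rw [Equiv.Perm.viaFintypeEmbedding_apply_image,
      Equiv.Perm.viaFintypeEmbedding_apply_image] at h7
    rw [f.injective h7]
  · intro π _
    rw [Equiv.Perm.sign_mul, Equiv.Perm.viaFintypeEmbedding_sign]
    have h8 : ∏ j, G j (σ j) ((σ * π.viaFintypeEmbedding f) j) =
        ∏ i, v i (σ (f i)) * v i (σ (f (π i))) := by
      symm
      refine Finset.prod_of_injOn f f.injective.injOn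
        (fun _ _ => Finset.mem_coe.2 (Finset.mem_univ _)) (fun j _ hj => ?_) (fun i _ => ?_)
      · have hj' : j ∉ Set.range f := by simpa using hj
        rw [hG2 j hj', Equiv.Perm.mul_apply,
          Equiv.Perm.viaFintypeEmbedding_apply_notMem_range _ _ hj', Matrix.one_apply_eq]
      · rw [hG1, Equiv.Perm.mul_apply, Equiv.Perm.viaFintypeEmbedding_apply_image]
    rw [h8, Finset.prod_mul_distrib]
    push_cast
    rw [← mul_assoc ((sign σ : ℤ) : ℝ), sign_mul_self]
    simp only [Function.comp_apply, Matrix.of_apply]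
    ring

lemma abs_permSum_le {n : ℕ} (G : Fin n → Matrix (Fin n) (Fin n) ℝ) (C : ℝ)
    (h : ∀ σ τ : Equiv.Perm (Fin n), |∏ j, G j (σ j) (τ j)| ≤ C) :
    |permSum G| ≤ (n.factorial : ℝ) ^ 2 * C := by
  have hs : ∀ σ : Equiv.Perm (Fin n), |((sign σ : ℤ) : ℝ)| = 1 := fun σ => by
    rcases Int.units_eq_one_or (sign σ) with h | h <;> simp [h]
  refine (Finset.abs_sum_le_sum_abs _ _).trans ?_
  refine (Finset.sum_le_card_nsmul _ _ ((n.factorial : ℝ) * C) fun σ _ => ?_).trans (le_of_eq ?_)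
  · refine (Finset.abs_sum_le_sum_abs _ _).trans ?_
    refine (Finset.sum_le_card_nsmul _ _ C fun τ _ => ?_).trans (le_of_eq ?_)
    · rw [abs_mul, abs_mul, hs, hs, one_mul, one_mul]
      exact h σ τ
    · rw [Finset.card_univ, Fintype.card_perm, Fintype.card_fin, nsmul_eq_mul]
  · rw [Finset.card_univ, Fintype.card_perm, Fintype.card_fin, nsmul_eq_mul]
    ring

end PermutationSums

/-! ### Integrals of squared Slater determinants -/

section Integrals

open Equiv.Perm (sign)

lemma integral_sum_prod {ι κ : Type*} [Fintype ι] [Fintype κ] (μ : ι → Measure ℝ)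
    [∀ i, SigmaFinite (μ i)] (c : κ → ℝ) (g : κ → ι → ℝ → ℝ)
    (hg : ∀ s i, Integrable (g s i) (μ i)) :
    Integrable (fun y : ι → ℝ => ∑ s, c s * ∏ i, g s i (y i)) (Measure.pi μ) ∧
      ∫ y : ι → ℝ, ∑ s, c s * ∏ i, g s i (y i) ∂(Measure.pi μ) =
        ∑ s, c s * ∏ i, ∫ t, g s i t ∂(μ i) := by
  have h1 : ∀ s, Integrable (fun y : ι → ℝ => c s * ∏ i, g s i (y i)) (Measure.pi μ) :=
    fun s => (Integrable.fintype_prod (hg s)).const_mul _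
  refine ⟨integrable_finsetSum _ fun s _ => h1 s, ?_⟩
  rw [integral_finsetSum _ fun s _ => h1 s]
  refine Finset.sum_congr rfl fun s _ => ?_
  rw [integral_const_mul, integral_fintype_prod_eq_prod]

lemma slater_sq (n : ℕ) (k : Fin n → ℕ) (x : Fin n → ℝ) :
    |slater n k x| ^ 2 = 1 / (n.factorial : ℝ) *
      permSum (fun j => Matrix.of fun a b => phi (k a) (x j) * phi (k b) (x j)) := by
  have h := permSum_rank_one (Matrix.of fun i j : Fin n => phi (k i) (x j))
  simp only [Matrix.of_apply] at h
  rw [h, sq_abs, slater, mul_pow, div_pow, one_pow, Real.sq_sqrt (Nat.cast_nonneg _)]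

/-- The variable `x j` occurs only in slot `j`, so Fubini replaces each rank-one matrix by its
entrywise integral, an overlap matrix. -/
lemma integral_slater_sq_pi (n : ℕ) (k : Fin n → ℕ) (B : Fin n → Set ℝ) :
    IntegrableOn (fun x => |slater n k x| ^ 2) (Set.univ.pi B) ∧
      ∫ x in Set.univ.pi B, |slater n k x| ^ 2 =
        1 / (n.factorial : ℝ) * permSum (fun j => (overlap (B j)).submatrix k k) := by
  have h := integral_sum_prod (fun j => volume.restrict (B j))
    (fun s : Equiv.Perm (Fin n) × Equiv.Perm (Fin n) =>
      ((sign s.1 : ℤ) : ℝ) * ((sign s.2 : ℤ) : ℝ))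
    (fun s j t => phi (k (s.1 j)) t * phi (k (s.2 j)) t)
    (fun s j => (integrable_phi_mul_phi _ _).restrict)
  have h1 : ∀ x : Fin n → ℝ, ∑ s : Equiv.Perm (Fin n) × Equiv.Perm (Fin n),
      ((sign s.1 : ℤ) : ℝ) * ((sign s.2 : ℤ) : ℝ) *
        ∏ j, phi (k (s.1 j)) (x j) * phi (k (s.2 j)) (x j) =
      permSum (fun j => Matrix.of fun a b => phi (k a) (x j) * phi (k b) (x j)) := fun x =>
    Fintype.sum_prod_type _
  simp_rw [h1] at h
  rw [Fintype.sum_prod_type] at h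
  rw [IntegrableOn, volume_pi, Measure.restrict_pi_pi]
  simp_rw [slater_sq]
  refine ⟨h.1.const_mul _, ?_⟩
  rw [integral_const_mul, h.2]
  rfl

lemma overlap_univ : overlap Set.univ = 1 := by
  ext j k
  rw [overlap, Matrix.of_apply, setIntegral_univ, integral_phi_mul_phi, Matrix.one_apply]

lemma integral_slater_sq_pi_const {n : ℕ} (k : State n) (A : Set ℝ) :
    ∫ x in Set.univ.pi fun _ => A, |slater n k.1 x| ^ 2 =
      principalMinor (overlap A) (occupied k) := by
  rw [(integral_slater_sq_pi n k.1 _).2, permSum_const, occupied, principalMinor_eq_det,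
    ← mul_assoc, one_div_mul_cancel (by positivity), one_mul]
  rfl

lemma integral_slater_sq {n : ℕ} (k : State n) :
    Integrable (fun x => |slater n k.1 x| ^ 2) ∧ ∫ x, |slater n k.1 x| ^ 2 = 1 := by
  have h1 := (integral_slater_sq_pi n k.1 fun _ => Set.univ).1
  have h2 := integral_slater_sq_pi_const k Set.univ
  rw [Set.pi_univ] at h1 h2
  rw [integrableOn_univ] at h1
  rw [setIntegral_univ, overlap_univ] at h2
  refine ⟨h1, h2.trans ?_⟩
  rw [principalMinor, Matrix.submatrix_one _ Subtype.val_injective, Matrix.det_one]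

lemma projectionKernel_occupied {m n : ℕ} (x : Fin m → ℝ) (k : State n) :
    projectionKernel x (occupied k) =
      Matrix.of fun i j => ∑ a, phi (k.1 a) (x i) * phi (k.1 a) (x j) := by
  ext i j
  simp only [projectionKernel, gram, Matrix.of_apply, Pi.one_apply, one_mul]
  rw [sum_occupied k fun l => phi l (x i) * phi l (x j)]

/-- Integrating out all but the first `m` variables of a Slater determinant. -/
lemma integral_slater_sq_append {m n : ℕ} (hmn : m ≤ n) (k : State n) (x : Fin m → ℝ) :
    Integrable (fun y : Fin (n - m) → ℝ => |slater n k.1 fun i : Fin n =>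
      if h : (i : ℕ) < m then x ⟨i, h⟩ else y ⟨i - m, by omega⟩| ^ 2) ∧
    ∫ y : Fin (n - m) → ℝ, |slater n k.1 fun i : Fin n =>
      if h : (i : ℕ) < m then x ⟨i, h⟩ else y ⟨i - m, by omega⟩| ^ 2 =
      1 / (n.factorial : ℝ) * (((n - m).factorial : ℝ) *
        (projectionKernel x (occupied k)).det) := by
  let e : Fin m ⊕ Fin (n - m) ≃ Fin n := finSumFinEquiv.trans (finCongr (by omega))
  have hel : ∀ i : Fin m, ((e (Sum.inl i) : Fin n) : ℕ) = i := fun i => by simp [e]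
  have her : ∀ l : Fin (n - m), ((e (Sum.inr l) : Fin n) : ℕ) = m + l := fun l => by simp [e]
  have h := integral_sum_prod (fun _ : Fin (n - m) => (volume : Measure ℝ))
    (fun s : Equiv.Perm (Fin n) × Equiv.Perm (Fin n) =>
      ((sign s.1 : ℤ) : ℝ) * ((sign s.2 : ℤ) : ℝ) * ∏ i : Fin m,
        phi (k.1 (s.1 (e (Sum.inl i)))) (x i) * phi (k.1 (s.2 (e (Sum.inl i)))) (x i))
    (fun s l t => phi (k.1 (s.1 (e (Sum.inr l)))) t * phi (k.1 (s.2 (e (Sum.inr l)))) t)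
    (fun s j => integrable_phi_mul_phi _ _)
  have h1 : ∀ y : Fin (n - m) → ℝ, ∑ s : Equiv.Perm (Fin n) × Equiv.Perm (Fin n),
      ((sign s.1 : ℤ) : ℝ) * ((sign s.2 : ℤ) : ℝ) * (∏ i : Fin m,
        phi (k.1 (s.1 (e (Sum.inl i)))) (x i) * phi (k.1 (s.2 (e (Sum.inl i)))) (x i)) *
        ∏ l, phi (k.1 (s.1 (e (Sum.inr l)))) (y l) * phi (k.1 (s.2 (e (Sum.inr l)))) (y l) =
      permSum (fun i : Fin n => Matrix.of fun a b =>
        phi (k.1 a) (if h : (i : ℕ) < m then x ⟨i, h⟩ else y ⟨i - m, by omega⟩) *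
        phi (k.1 b) (if h : (i : ℕ) < m then x ⟨i, h⟩ else y ⟨i - m, by omega⟩)) := by
    intro y
    rw [Fintype.sum_prod_type, permSum]
    refine Finset.sum_congr rfl fun σ _ => Finset.sum_congr rfl fun τ _ => ?_
    rw [mul_assoc, ← e.prod_comp, Fintype.prod_sum_type]
    congr 2
    · refine Finset.prod_congr rfl fun i _ => ?_
      simp [hel]
    · refine Finset.prod_congr rfl fun l _ => ?_
      simp [her]
  simp_rw [h1] at h
  simp_rw [slater_sq]
  refine ⟨h.1.const_mul _, ?_⟩
  rw [integral_const_mul]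
  congr 1
  rw [volume_pi, h.2, projectionKernel_occupied]
  -- Slots of fixed variables stay of rank one; integrated slots become the identity by
  -- orthonormality.
  let G : Fin n → Matrix (Fin n) (Fin n) ℝ := fun j => Matrix.of fun a b =>
    Sum.elim (fun i => phi (k.1 a) (x i) * phi (k.1 b) (x i))
      (fun _ => if a = b then 1 else 0) (e.symm j)
  have h2 := permSum_embedding (Function.Embedding.inl.trans e.toEmbedding)
    (fun i a => phi (k.1 a) (x i)) G (fun i a b => by simp [G]) (fun j hj => by
      obtain ⟨s, rfl⟩ := e.surjective j
      rcases s with i | l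
      · exact absurd ⟨i, rfl⟩ hj
      · ext a b
        simp [G, Matrix.one_apply])
  rw [← h2, permSum, Fintype.sum_prod_type]
  refine Finset.sum_congr rfl fun σ _ => Finset.sum_congr rfl fun τ _ => ?_
  rw [mul_assoc, ← e.prod_comp (fun j => G j (σ j) (τ j)), Fintype.prod_sum_type]
  congr 2
  · refine Finset.prod_congr rfl fun i _ => ?_
    simp [G]
  · refine Finset.prod_congr rfl fun l _ => ?_
    rw [integral_phi_mul_phi]
    simp [G, k.2.injective.eq_iff]

end Integrals

/-! ### Termwise integration of the density -/

section Law

variable {q : ℝ}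

lemma weight_pos (hq0 : 0 < q) (n : ℕ) (k : Fin n → ℕ) : 0 < weight n q k :=
  Real.rpow_pos_of_pos hq0 _

lemma summable_weight_mul (hq0 : 0 < q) (n : ℕ) {c : Finset ℕ → ℝ}
    (hc : Summable fun S : Finset ℕ => (∏ i ∈ S, q ^ i) * c S) :
    Summable fun k : State n => weight n q k.1 * c (occupied k) := by
  simp_rw [weight_eq hq0, mul_assoc]
  exact (hc.comp_injective (occupied_injective n)).mul_left _

lemma summable_weight (hq0 : 0 < q) (hq1 : q < 1) (n : ℕ) :
    Summable fun k : State n => weight n q k.1 := by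
  have := summable_weight_mul hq0 n (c := fun _ => 1)
    (by simpa using summable_prod_pow hq0 hq1)
  simpa using this

lemma summable_weight_mul_prod_phiBound (hq0 : 0 < q) (hq1 : q < 1) {R : ℝ} (hR : 0 ≤ R)
    (n p : ℕ) : Summable fun k : State n => weight n q k.1 * ∏ i, phiBound R (k.1 i) ^ p := by
  have h := summable_weight_mul hq0 n (c := fun S => ∏ i ∈ S, phiBound R i ^ p) ?_
  · simpa only [prod_occupied _ fun i => phiBound R i ^ p] using h
  · simp_rw [← Finset.prod_mul_distrib]
    refine summable_finsetProd_of_summable_nonneg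
      (fun i => by have := phiBound_pos hR i; positivity)
      ((summable_phiBound_pow_mul hq0 hq1 hR p).congr fun i => mul_comm _ _)

lemma slater_sq_le {R : ℝ} (hR : 0 ≤ R) {n : ℕ} (k : Fin n → ℕ) {x : Fin n → ℝ}
    (hx : ∀ j, |x j| ≤ R) :
    |slater n k x| ^ 2 ≤ n.factorial * ∏ i, phiBound R (k i) ^ 2 := by
  have h : |(permSum (fun j => Matrix.of fun a b => phi (k a) (x j) * phi (k b) (x j)))| ≤
      (n.factorial : ℝ) ^ 2 * ∏ i, phiBound R (k i) ^ 2 := by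
    refine abs_permSum_le _ _ fun σ τ => ?_
    simp only [Matrix.of_apply]
    rw [Finset.abs_prod]
    have h1 : ∏ i, phiBound R (k i) ^ 2 =
        ∏ j, phiBound R (k (σ j)) * phiBound R (k (τ j)) := by
      rw [Finset.prod_mul_distrib, Equiv.prod_comp σ fun i => phiBound R (k i),
        Equiv.prod_comp τ fun i => phiBound R (k i), Finset.prod_pow, sq]
    rw [h1]
    refine Finset.prod_le_prod (fun _ _ => abs_nonneg _) fun j _ => ?_
    rw [abs_mul]
    exact mul_le_mul (abs_phi_le_phiBound (hx j) _) (abs_phi_le_phiBound (hx j) _)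
      (abs_nonneg _) (phiBound_pos hR _).le
  rw [slater_sq]
  refine (mul_le_mul_of_nonneg_left ((le_abs_self _).trans h) (by positivity)).trans
    (le_of_eq ?_)
  have : (n.factorial : ℝ) ≠ 0 := by positivity
  field_simp

lemma summable_slater_sq_mul_weight (hq0 : 0 < q) (hq1 : q < 1) {n : ℕ} (x : Fin n → ℝ) :
    Summable fun k : State n => |slater n k.1 x| ^ 2 * weight n q k.1 := by
  obtain ⟨R, hR, hx⟩ := exists_abs_le x
  refine Summable.of_nonneg_of_le (fun k => ?_) (fun k => ?_)
    ((summable_weight_mul_prod_phiBound hq0 hq1 hR n 2).mul_left (n.factorial : ℝ))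
  · have := weight_pos hq0 n k.1
    positivity
  · refine (mul_le_mul_of_nonneg_right (slater_sq_le hR k.1 hx)
      (weight_pos hq0 n k.1).le).trans (le_of_eq ?_)
    ring

lemma correlation_eq (hq0 : 0 < q) (hq1 : q < 1) {m n : ℕ} (hmn : m ≤ n) (x : Fin m → ℝ) :
    correlation n m q x = canonicalMean n q fun S => (projectionKernel x S).det := by
  have hI := fun k : State n => integral_slater_sq_append hmn k x
  have hsum : Summable fun k : State n =>
      weight n q k.1 * (projectionKernel x (occupied k)).det := by
    refine summable_weight_mul hq0 n (c := fun S => (projectionKernel x S).det) ?_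
    refine Summable.of_norm ((summable_det_projectionKernel hq0 hq1 zero_le_one x).congr
      fun S => ?_)
    rw [norm_mul, Real.norm_of_nonneg (Finset.prod_nonneg fun i _ => pow_nonneg hq0.le i)]
    simp
  -- The terms are nonnegative, so their norms have the already computed integrals and summability
  -- is that of `hsum`.
  have h := integral_tsum_of_summable_integral_norm (μ := volume)
    (F := fun (k : State n) (y : Fin (n - m) → ℝ) => |slater n k.1 fun i : Fin n =>
      if h : (i : ℕ) < m then x ⟨i, h⟩ else y ⟨i - m, by omega⟩| ^ 2 * weight n q k.1)
    (fun k => (hI k).1.mul_const _) ?_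
  · have h1 : ∀ k : State n, ∫ y : Fin (n - m) → ℝ, |slater n k.1 fun i : Fin n =>
        if h : (i : ℕ) < m then x ⟨i, h⟩ else y ⟨i - m, by omega⟩| ^ 2 * weight n q k.1 =
        (((n - m).factorial : ℝ) / n.factorial) *
          (weight n q k.1 * (projectionKernel x (occupied k)).det) := fun k => by
      rw [integral_mul_const, (hI k).2]
      ring
    rw [correlation, canonicalMean]
    simp only [density]
    rw [integral_const_mul, ← h]
    simp_rw [h1]
    rw [tsum_mul_left]
    have h2 : (n.factorial : ℝ) ≠ 0 := by positivity
    have h3 : ((n - m).factorial : ℝ) ≠ 0 := by positivity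
    field_simp
  · refine (hsum.mul_left (((n - m).factorial : ℝ) / n.factorial)).congr fun k => ?_
    simp_rw [Real.norm_of_nonneg (mul_nonneg (sq_nonneg _) (weight_pos hq0 n k.1).le)]
    rw [integral_mul_const, (hI k).2]
    ring

lemma law_apply (hq0 : 0 < q) (hq1 : q < 1) (n : ℕ) {s : Set (Fin n → ℝ)} (hs : MeasurableSet s) :
    law n q s = ENNReal.ofReal (1 / partitionFunction n q *
      ∑' k : State n, weight n q k.1 * ∫ x in s, |slater n k.1 x| ^ 2) := by
  have hZ := (partitionFunction_pos hq0 hq1 n).le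
  have hnn : ∀ (k : State n) (x : Fin n → ℝ), 0 ≤ |slater n k.1 x| ^ 2 * weight n q k.1 :=
    fun k x => mul_nonneg (sq_nonneg _) (weight_pos hq0 n k.1).le
  have hint : ∀ k : State n, Integrable (fun x => |slater n k.1 x| ^ 2 * weight n q k.1) :=
    fun k => (integral_slater_sq k).1.mul_const _
  have hd : ∀ x : Fin n → ℝ, ENNReal.ofReal (density n q x) =
      ENNReal.ofReal (1 / partitionFunction n q) *
        ∑' k : State n, ENNReal.ofReal (|slater n k.1 x| ^ 2 * weight n q k.1) := by
    intro x
    rw [density, ENNReal.ofReal_mul (by positivity), ENNReal.ofReal_tsum_of_nonneg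
      (fun k => hnn k x) (summable_slater_sq_mul_weight hq0 hq1 x)]
  rw [law, withDensity_apply _ hs]
  simp_rw [hd]
  rw [lintegral_const_mul' _ _ ENNReal.ofReal_ne_top,
    lintegral_tsum fun k => (hint k).1.restrict.aemeasurable.ennreal_ofReal]
  have h1 : ∀ k : State n,
      ∫⁻ x in s, ENNReal.ofReal (|slater n k.1 x| ^ 2 * weight n q k.1) =
        ENNReal.ofReal (weight n q k.1 * ∫ x in s, |slater n k.1 x| ^ 2) := by
    intro k
    rw [← ofReal_integral_eq_lintegral_ofReal (hint k).restrict
      (Eventually.of_forall fun x => hnn k x), integral_mul_const, mul_comm]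
  simp_rw [h1]
  rw [← ENNReal.ofReal_tsum_of_nonneg, ENNReal.ofReal_mul (by positivity)]
  · exact fun k => mul_nonneg (weight_pos hq0 n k.1).le (integral_nonneg fun x => sq_nonneg _)
  · refine Summable.of_nonneg_of_le
      (fun k => mul_nonneg (weight_pos hq0 n k.1).le (integral_nonneg fun x => sq_nonneg _))
      (fun k => ?_) (summable_weight hq0 hq1 n)
    refine mul_le_of_le_one_right (weight_pos hq0 n k.1).le ?_
    rw [← (integral_slater_sq k).2]
    exact setIntegral_le_integral (integral_slater_sq k).1
      (Eventually.of_forall fun x => sq_nonneg _)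

lemma law_real_apply (hq0 : 0 < q) (hq1 : q < 1) (n : ℕ) {s : Set (Fin n → ℝ)}
    (hs : MeasurableSet s) :
    (law n q).real s = 1 / partitionFunction n q *
      ∑' k : State n, weight n q k.1 * ∫ x in s, |slater n k.1 x| ^ 2 := by
  have hZ := (partitionFunction_pos hq0 hq1 n).le
  rw [Measure.real, law_apply hq0 hq1 n hs, ENNReal.toReal_ofReal]
  exact mul_nonneg (by positivity) (tsum_nonneg fun k =>
    mul_nonneg (weight_pos hq0 n k.1).le (integral_nonneg fun x => sq_nonneg _))

lemma isFiniteMeasure_law (hq0 : 0 < q) (hq1 : q < 1) (n : ℕ) : IsFiniteMeasure (law n q) :=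
  ⟨by rw [law_apply hq0 hq1 n MeasurableSet.univ]; exact ENNReal.ofReal_lt_top⟩

lemma law_real_forall_mem (hq0 : 0 < q) (hq1 : q < 1) (n : ℕ) {A : Set ℝ} (hA : MeasurableSet A) :
    (law n q).real {x | ∀ i, x i ∈ A} = canonicalMean n q (principalMinor (overlap A)) := by
  have h1 : {x : Fin n → ℝ | ∀ i, x i ∈ A} = Set.univ.pi fun _ => A := by
    ext x
    simp
  rw [h1, law_real_apply hq0 hq1 n (MeasurableSet.univ_pi fun _ => hA), canonicalMean]
  simp_rw [integral_slater_sq_pi_const]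

end Law

/-! ### Correlation functions as limits of probabilities -/

section Limit

open Equiv.Perm (sign)

variable {q : ℝ}

lemma tendsto_average_Ico {h : ℝ → ℝ} (hh : Continuous h) (x : ℝ) :
    Tendsto (fun Δ : ℝ => Δ⁻¹ * ∫ t in Set.Ico x (x + Δ), h t) (𝓝[>] 0) (𝓝 (h x)) := by
  have h1 : HasDerivAt (fun u => ∫ t in x..u, h t) (h x) x :=
    (hh.integral_hasStrictDerivAt x x).hasDerivAt
  refine h1.tendsto_slope_zero_right.congr' ?_
  filter_upwards [self_mem_nhdsWithin] with Δ hΔ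
  have hΔ' : (0 : ℝ) < Δ := hΔ
  rw [intervalIntegral.integral_same, sub_zero, smul_eq_mul,
    intervalIntegral.integral_of_le (by linarith), integral_Ico_eq_integral_Ioc]

/-- The configurations for which the particles in `J` lie in small sets have small probability. -/
lemma setIntegral_slater_sq_le {R : ℝ} (hR : 0 ≤ R) {n : ℕ} (k : Fin n → ℕ) (B : Fin n → Set ℝ)
    (hB : ∀ j, MeasurableSet (B j)) (J : Finset (Fin n)) {Δ : ℝ} (hΔ : 0 ≤ Δ)
    (hJ : ∀ j ∈ J, (∀ t ∈ B j, |t| ≤ R) ∧ volume (B j) ≤ ENNReal.ofReal Δ) :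
    ∫ x in Set.univ.pi B, |slater n k x| ^ 2 ≤
      Δ ^ J.card * (n.factorial * ∏ i, phiBound R (k i) ^ 2) := by
  -- A slot in `J` gains a factor `Δ`; any other overlap is at most `1`, hence below the same
  -- majorant because `phiBound` is at least `1`.
  have hov : ∀ j a b, |overlap (B j) a b| ≤
      (if j ∈ J then Δ else 1) * (phiBound R a * phiBound R b) := by
    intro j a b
    have hab : 1 ≤ phiBound R a * phiBound R b :=
      one_le_mul_of_one_le_of_one_le (one_le_phiBound hR a) (one_le_phiBound hR b)
    split_ifs with hj
    · have h1 := norm_setIntegral_le_of_norm_le_const (μ := volume) (s := B j)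
        (f := fun t => phi a t * phi b t) (C := phiBound R a * phiBound R b)
        ((hJ j hj).2.trans_lt ENNReal.ofReal_lt_top) fun t ht => by
          rw [norm_mul]
          exact mul_le_mul (abs_phi_le_phiBound ((hJ j hj).1 t ht) a)
            (abs_phi_le_phiBound ((hJ j hj).1 t ht) b) (norm_nonneg _) (phiBound_pos hR a).le
      refine h1.trans ?_
      rw [mul_comm]
      refine mul_le_mul_of_nonneg_right ?_ (zero_le_one.trans hab)
      exact ENNReal.toReal_le_of_le_ofReal hΔ (hJ j hj).2
    · rw [one_mul]
      exact (abs_overlap_le_one (B j) (hB j) a b).trans hab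
  have h : |permSum (fun j => (overlap (B j)).submatrix k k)| ≤
      (n.factorial : ℝ) ^ 2 * (Δ ^ J.card * ∏ i, phiBound R (k i) ^ 2) := by
    refine abs_permSum_le _ _ fun σ τ => ?_
    have h1 : Δ ^ J.card * ∏ i, phiBound R (k i) ^ 2 = ∏ j, (if j ∈ J then Δ else 1) *
        (phiBound R (k (σ j)) * phiBound R (k (τ j))) := by
      rw [Finset.prod_mul_distrib, Finset.prod_mul_distrib,
        Equiv.prod_comp σ fun i => phiBound R (k i),
        Equiv.prod_comp τ fun i => phiBound R (k i), Finset.prod_pow, sq,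
        Finset.prod_ite_mem, Finset.univ_inter, Finset.prod_const]
    rw [h1, Finset.abs_prod]
    exact Finset.prod_le_prod (fun _ _ => abs_nonneg _) fun j _ => hov j _ _
  rw [(integral_slater_sq_pi n k B).2]
  refine (mul_le_mul_of_nonneg_left ((le_abs_self _).trans h) (by positivity)).trans
    (le_of_eq ?_)
  have : (n.factorial : ℝ) ≠ 0 := by positivity
  field_simp

lemma summable_weight_mul_factorial (hq0 : 0 < q) (hq1 : q < 1) {R : ℝ} (hR : 0 ≤ R) (n : ℕ) :
    Summable fun k : State n =>
      weight n q k.1 * (n.factorial * ∏ i, phiBound R (k.1 i) ^ 2) :=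
  ((summable_weight_mul_prod_phiBound hq0 hq1 hR n 2).mul_left (n.factorial : ℝ)).congr
    fun k => by ring

/-- The constant is uniform in `B`, `J` and `Δ`; with `m + 1` constrained particles this gives the
error term `O(Δ ^ (m + 1))`. -/
lemma exists_law_real_pi_le (hq0 : 0 < q) (hq1 : q < 1) {R : ℝ} (hR : 0 ≤ R) (n : ℕ) :
    ∃ C, 0 ≤ C ∧ ∀ (B : Fin n → Set ℝ) (_ : ∀ j, MeasurableSet (B j)) (J : Finset (Fin n)) (Δ : ℝ),
      0 ≤ Δ → (∀ j ∈ J, (∀ t ∈ B j, |t| ≤ R) ∧ volume (B j) ≤ ENNReal.ofReal Δ) →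
      (law n q).real (Set.univ.pi B) ≤ C * Δ ^ J.card := by
  have hZ := partitionFunction_pos hq0 hq1 n
  refine ⟨1 / partitionFunction n q *
    ∑' k : State n, weight n q k.1 * (n.factorial * ∏ i, phiBound R (k.1 i) ^ 2), ?_, ?_⟩
  · refine mul_nonneg (by positivity) (tsum_nonneg fun k => ?_)
    have := weight_pos hq0 n k.1
    positivity
  · intro B hB J Δ hΔ hJ
    have hs := (summable_weight_mul_factorial hq0 hq1 hR n).mul_left (Δ ^ J.card)
    have hle : ∀ k : State n, weight n q k.1 * ∫ x in Set.univ.pi B, |slater n k.1 x| ^ 2 ≤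
        Δ ^ J.card * (weight n q k.1 * (n.factorial * ∏ i, phiBound R (k.1 i) ^ 2)) := by
      intro k
      refine (mul_le_mul_of_nonneg_left (setIntegral_slater_sq_le hR k.1 B hB J hΔ hJ)
        (weight_pos hq0 n k.1).le).trans (le_of_eq ?_)
      ring
    rw [law_real_apply hq0 hq1 n (MeasurableSet.univ_pi hB), mul_assoc]
    refine mul_le_mul_of_nonneg_left ?_ (by positivity)
    rw [mul_comm, ← tsum_mul_left]
    refine Summable.tsum_le_tsum hle (Summable.of_nonneg_of_le (fun k => ?_) hle hs) hs
    exact mul_nonneg (weight_pos hq0 n k.1).le (integral_nonneg fun _ => sq_nonneg _)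

/-- The constraints saying that, for all `i`, particle `f i` lies in `[x_i, x_i + Δ)`. -/
def cell {m n : ℕ} (x : Fin m → ℝ) (f : Fin m ↪ Fin n) (Δ : ℝ) (j : Fin n) : Set ℝ :=
  {t | ∀ i, f i = j → t ∈ Set.Ico (x i) (x i + Δ)}

lemma cell_apply {m n : ℕ} (x : Fin m → ℝ) (f : Fin m ↪ Fin n) (Δ : ℝ) (i : Fin m) :
    cell x f Δ (f i) = Set.Ico (x i) (x i + Δ) := by
  ext t
  simp only [cell, Set.mem_ofPred_eq]
  exact ⟨fun h => h i rfl, fun h i' hi' => f.injective hi' ▸ h⟩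

lemma cell_of_notMem {m n : ℕ} (x : Fin m → ℝ) (f : Fin m ↪ Fin n) (Δ : ℝ) {j : Fin n}
    (hj : j ∉ Set.range f) : cell x f Δ j = Set.univ := by
  ext t
  simp only [cell, Set.mem_ofPred_eq, Set.mem_univ, iff_true]
  exact fun i hi => absurd ⟨i, hi⟩ hj

lemma measurableSet_cell {m n : ℕ} (x : Fin m → ℝ) (f : Fin m ↪ Fin n) (Δ : ℝ) (j : Fin n) :
    MeasurableSet (cell x f Δ j) := by
  by_cases hj : j ∈ Set.range f
  · obtain ⟨i, rfl⟩ := hj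
    rw [cell_apply]
    exact measurableSet_Ico
  · rw [cell_of_notMem x f Δ hj]
    exact MeasurableSet.univ

lemma abs_le_of_mem_Ico {x R t Δ : ℝ} (hx : |x| ≤ R) (hΔ : Δ ≤ 1)
    (ht : t ∈ Set.Ico x (x + Δ)) : |t| ≤ R + 1 := by
  have h1 := abs_le.1 hx
  rw [abs_le]
  constructor <;> linarith [ht.1, ht.2]

lemma cell_bounds {m n : ℕ} {x : Fin m → ℝ} {R : ℝ} (hx : ∀ i, |x i| ≤ R) (f : Fin m ↪ Fin n)
    {Δ : ℝ} (hΔ : Δ ≤ 1) : ∀ j ∈ Finset.univ.map f,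
      (∀ t ∈ cell x f Δ j, |t| ≤ R + 1) ∧ volume (cell x f Δ j) ≤ ENNReal.ofReal Δ := by
  intro j hj
  obtain ⟨i, -, rfl⟩ := Finset.mem_map.1 hj
  rw [cell_apply, Real.volume_Ico, add_sub_cancel_left]
  exact ⟨fun t ht => abs_le_of_mem_Ico (hx i) hΔ ht, le_rfl⟩

/-- The factor `Δ ^ (-m)` is shared out, one `Δ⁻¹` per constrained slot. Averages over shrinking
intervals then turn those overlaps into rank-one matrices, while the free slots carry the identity.
-/
lemma tendsto_setIntegral_slater_sq_cell {m n : ℕ} (x : Fin m → ℝ) (f : Fin m ↪ Fin n)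
    (k : State n) :
    Tendsto (fun Δ : ℝ => 1 / Δ ^ m * ∫ y in Set.univ.pi (cell x f Δ), |slater n k.1 y| ^ 2)
      (𝓝[>] 0) (𝓝 (1 / (n.factorial : ℝ) * (((n - m).factorial : ℝ) *
        (projectionKernel x (occupied k)).det))) := by
  let G : Fin n → Matrix (Fin n) (Fin n) ℝ := fun j => Matrix.of fun a b =>
    if h : j ∈ Set.range f then phi (k.1 a) (x h.choose) * phi (k.1 b) (x h.choose)
    else if a = b then 1 else 0
  have hG1 : ∀ i a b, G (f i) a b = phi (k.1 a) (x i) * phi (k.1 b) (x i) := by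
    intro i a b
    have h : f i ∈ Set.range f := ⟨i, rfl⟩
    have h2 : h.choose = i := f.injective h.choose_spec
    simp only [G, Matrix.of_apply, dif_pos h, h2]
  have hG2 : ∀ j, j ∉ Set.range f → G j = 1 := by
    intro j hj
    ext a b
    simp only [G, Matrix.of_apply, dif_neg hj, Matrix.one_apply]
  have hP := permSum_embedding f (fun i a => phi (k.1 a) (x i)) G hG1 hG2
  rw [projectionKernel_occupied, ← hP]
  have hlim : ∀ j a b, Tendsto (fun Δ : ℝ =>
      (if j ∈ Finset.univ.map f then Δ⁻¹ else 1) * overlap (cell x f Δ j) (k.1 a) (k.1 b))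
      (𝓝[>] 0) (𝓝 (G j a b)) := by
    intro j a b
    by_cases hj : j ∈ Set.range f
    · obtain ⟨i, rfl⟩ := hj
      rw [hG1]
      simp only [Finset.mem_map', Finset.mem_univ, if_true, cell_apply]
      exact tendsto_average_Ico ((continuous_phi _).mul (continuous_phi _)) (x i)
    · have hj' : j ∉ Finset.univ.map f := by simpa using hj
      simp only [if_neg hj', cell_of_notMem x f _ hj, one_mul, overlap_univ, hG2 j hj,
        Matrix.one_apply, k.2.injective.eq_iff]
      exact tendsto_const_nhds
  have hsum : Tendsto (fun Δ : ℝ => permSum fun j => Matrix.of fun a b =>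
      (if j ∈ Finset.univ.map f then Δ⁻¹ else 1) * overlap (cell x f Δ j) (k.1 a) (k.1 b))
      (𝓝[>] 0) (𝓝 (permSum G)) :=
    tendsto_finsetSum _ fun σ _ => tendsto_finsetSum _ fun τ _ =>
      (tendsto_finsetProd _ fun j _ => hlim j (σ j) (τ j)).const_mul _
  refine (hsum.const_mul _).congr fun Δ => ?_
  rw [(integral_slater_sq_pi n k.1 _).2, mul_left_comm]
  congr 1
  rw [permSum, permSum, Finset.mul_sum]
  refine Finset.sum_congr rfl fun σ _ => ?_
  rw [Finset.mul_sum]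
  refine Finset.sum_congr rfl fun τ _ => ?_
  simp only [Matrix.of_apply, Matrix.submatrix_apply]
  rw [Finset.prod_mul_distrib, Finset.prod_ite_mem, Finset.univ_inter, Finset.prod_const,
    Finset.card_map, Finset.card_univ, Fintype.card_fin, inv_pow, one_div]
  ring

lemma tendsto_law_cell (hq0 : 0 < q) (hq1 : q < 1) {m n : ℕ} (x : Fin m → ℝ)
    (f : Fin m ↪ Fin n) :
    Tendsto (fun Δ : ℝ => 1 / Δ ^ m * (law n q).real (Set.univ.pi (cell x f Δ))) (𝓝[>] 0)
      (𝓝 (((n - m).factorial : ℝ) / n.factorial *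
        canonicalMean n q fun S => (projectionKernel x S).det)) := by
  obtain ⟨R, hR, hx⟩ := exists_abs_le x
  have hR1 : 0 ≤ R + 1 := by linarith
  have h := tendsto_tsum_of_dominated_convergence (𝓕 := 𝓝[>] (0 : ℝ))
    (f := fun (Δ : ℝ) (k : State n) =>
      weight n q k.1 * (1 / Δ ^ m * ∫ y in Set.univ.pi (cell x f Δ), |slater n k.1 y| ^ 2))
    (summable_weight_mul_factorial hq0 hq1 hR1 n)
    (fun k => (tendsto_setIntegral_slater_sq_cell x f k).const_mul (weight n q k.1)) ?_
  · have h2 := h.const_mul (1 / partitionFunction n q)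
    have h3 : 1 / partitionFunction n q * ∑' k : State n, weight n q k.1 *
        (1 / (n.factorial : ℝ) * (((n - m).factorial : ℝ) *
          (projectionKernel x (occupied k)).det)) =
        ((n - m).factorial : ℝ) / n.factorial *
          canonicalMean n q fun S => (projectionKernel x S).det := by
      rw [canonicalMean, mul_left_comm]
      congr 1
      rw [← tsum_mul_left]
      exact tsum_congr fun k => by ring
    rw [h3] at h2
    refine h2.congr fun Δ => ?_
    rw [law_real_apply hq0 hq1 n (MeasurableSet.univ_pi (measurableSet_cell x f Δ)),
      mul_left_comm]
    congr 1
    rw [← tsum_mul_left]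
    exact tsum_congr fun k => by ring
  · have h1 : ∀ᶠ Δ : ℝ in 𝓝[>] 0, Δ ≤ 1 :=
      nhdsWithin_le_nhds (Iic_mem_nhds zero_lt_one)
    filter_upwards [self_mem_nhdsWithin, h1] with Δ hΔ0 hΔ1 k
    have hΔ0' : (0 : ℝ) < Δ := hΔ0
    have hb := setIntegral_slater_sq_le hR1 k.1 (cell x f Δ) (measurableSet_cell x f Δ)
      (Finset.univ.map f) hΔ0'.le (cell_bounds hx f hΔ1)
    rw [Finset.card_map, Finset.card_univ, Fintype.card_fin] at hb
    have h0 : 0 ≤ ∫ y in Set.univ.pi (cell x f Δ), |slater n k.1 y| ^ 2 :=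
      integral_nonneg fun _ => sq_nonneg _
    have hw := weight_pos hq0 n k.1
    rw [Real.norm_of_nonneg (by positivity)]
    refine mul_le_mul_of_nonneg_left ?_ hw.le
    rw [one_div, inv_mul_le_iff₀ (by positivity)]
    exact hb

/-- There are `n! / (n - m)!` embeddings if `m ≤ n`. If `m > n` there are none, and the right side
vanishes as well: an `m × m` Gram matrix of rank at most `n` is singular. -/
lemma sum_embedding_const {m n : ℕ} (x : Fin m → ℝ) :
    ∑ _f : Fin m ↪ Fin n, ((n - m).factorial : ℝ) / n.factorial *
      canonicalMean n q (fun S => (projectionKernel x S).det) =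
      canonicalMean n q fun S => (projectionKernel x S).det := by
  rw [Finset.sum_const, Finset.card_univ, Fintype.card_embedding_eq, Fintype.card_fin,
    Fintype.card_fin, nsmul_eq_mul]
  by_cases hmn : m ≤ n
  · have h := Nat.factorial_mul_descFactorial hmn
    have h' : ((n - m).factorial : ℝ) * (n.descFactorial m : ℝ) = n.factorial := by
      exact_mod_cast h
    have h2 : (n.factorial : ℝ) ≠ 0 := by positivity
    rw [← mul_assoc, ← mul_div_assoc, mul_comm (n.descFactorial m : ℝ), h', div_self h2, one_mul]
  · have h0 : canonicalMean n q (fun S => (projectionKernel x S).det) = 0 := by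
      rw [canonicalMean]
      simp only [projectionKernel_occupied]
      have h1 : ∀ k : State n, (Matrix.of fun i j : Fin m =>
          ∑ a, phi (k.1 a) (x i) * phi (k.1 a) (x j)).det = 0 := fun k =>
        det_sum_mul_eq_zero (not_le.1 hmn) fun i a => phi (k.1 a) (x i)
      simp [h1]
    simp [h0]

lemma eventually_disjoint_Ico {m : ℕ} {x : Fin m → ℝ} (hx : Function.Injective x) :
    ∀ᶠ Δ : ℝ in 𝓝[>] 0, ∀ i j, i ≠ j →
      Disjoint (Set.Ico (x i) (x i + Δ)) (Set.Ico (x j) (x j + Δ)) := by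
  rw [eventually_all]
  intro i
  rw [eventually_all]
  intro j
  by_cases hij : i = j
  · simp [hij]
  · have h0 : 0 < |x i - x j| := abs_pos.2 (sub_ne_zero.2 fun h => hij (hx h))
    have h1 : ∀ᶠ Δ : ℝ in 𝓝[>] 0, Δ < |x i - x j| := nhdsWithin_le_nhds (Iio_mem_nhds h0)
    filter_upwards [h1] with Δ hΔ _
    rw [Set.disjoint_left]
    intro t h1 h2
    have : |x i - x j| ≤ Δ := abs_le.2 ⟨by linarith [h1.1, h1.2, h2.1, h2.2],
      by linarith [h1.1, h1.2, h2.1, h2.2]⟩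
    linarith

/-- A Bonferroni inequality: the union of finitely many events, disjoint outside of `N`. -/
lemma sum_measureReal_le_of_disjoint_sdiff {α ι : Type*} [MeasurableSpace α] (μ : Measure α)
    [IsFiniteMeasure μ] [Fintype ι] (E : ι → Set α) (N : Set α) (hE : ∀ i, MeasurableSet (E i))
    (hN : MeasurableSet N) (hd : ∀ i j, i ≠ j → E i ∩ E j ⊆ N) :
    ∑ i, μ.real (E i) - Fintype.card ι * μ.real N ≤ μ.real (⋃ i, E i) := by
  have h1 : μ.real (⋃ i, E i \ N) = ∑ i, μ.real (E i \ N) := by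
    refine measureReal_iUnion_fintype (fun i j hij => ?_) fun i => (hE i).diff hN
    rw [Function.onFun, Set.disjoint_left]
    exact fun y h1 h2 => h1.2 (hd i j hij ⟨h1.1, h2.1⟩)
  have h2 : μ.real (⋃ i, E i \ N) ≤ μ.real (⋃ i, E i) :=
    measureReal_mono (Set.iUnion_mono fun i => Set.sdiff_subset)
  have h3 : ∀ i ∈ (Finset.univ : Finset ι), μ.real (E i) - μ.real N ≤ μ.real (E i \ N) :=
    fun i _ => le_measureReal_sdiff
  have h4 := Finset.sum_le_sum h3
  rw [Finset.sum_sub_distrib, Finset.sum_const, Finset.card_univ, nsmul_eq_mul] at h4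
  linarith

/-- For disjoint intervals the event is the union, over embeddings `f`, of the events that particle
`f i` is in interval `i`. Two different embeddings can both occur only if some interval holds two
particles, so the probability is squeezed between the sum of the pieces and that sum minus `O(Δ ^ (m
+ 1))`. -/
lemma tendsto_law_occupied (hq0 : 0 < q) (hq1 : q < 1) {m : ℕ} (n : ℕ) {x : Fin m → ℝ}
    (hx : Function.Injective x) :
    Tendsto (fun Δ : ℝ => 1 / Δ ^ m * (law n q).real
        {y | ∀ i : Fin m, ∃ j : Fin n, y j ∈ Set.Ico (x i) (x i + Δ)}) (𝓝[>] 0)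
      (𝓝 (canonicalMean n q fun S => (projectionKernel x S).det)) := by
  have := isFiniteMeasure_law hq0 hq1 n
  obtain ⟨R, hR, hxR⟩ := exists_abs_le x
  obtain ⟨C, hC0, hC⟩ := exists_law_real_pi_le hq0 hq1 (show 0 ≤ R + 1 by linarith) n
  -- An element records an assignment `f`, an interval, and one further particle placed in that
  -- interval.
  let D : Type := {d : (Fin m ↪ Fin n) × Fin m × Fin n // d.2.2 ∉ Set.range d.1}
  let B : ℝ → D → Fin n → Set ℝ := fun Δ d =>
    Function.update (cell x d.1.1 Δ) d.1.2.2 (Set.Ico (x d.1.2.1) (x d.1.2.1 + Δ))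
  have hD : Fintype D := Fintype.ofFinite D
  have hBm : ∀ Δ d j, MeasurableSet (B Δ d j) := by
    intro Δ d j
    by_cases hj : j = d.1.2.2
    · subst hj
      simp only [B, Function.update_self]
      exact measurableSet_Ico
    · simp only [B, Function.update_of_ne hj]
      exact measurableSet_cell _ _ _ _
  let N : ℝ → Set (Fin n → ℝ) := fun Δ => ⋃ d, Set.univ.pi (B Δ d)
  have hNm : ∀ Δ, MeasurableSet (N Δ) := fun Δ =>
    MeasurableSet.iUnion fun d => MeasurableSet.univ_pi (hBm Δ d)
  have hN : ∀ Δ : ℝ, 0 < Δ → Δ ≤ 1 →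
      (law n q).real (N Δ) ≤ Fintype.card D * C * Δ ^ (m + 1) := by
    intro Δ hΔ0 hΔ1
    refine (measureReal_iUnion_fintype_le _).trans ?_
    refine (Finset.sum_le_card_nsmul _ _ (C * Δ ^ (m + 1)) fun d _ => ?_).trans (le_of_eq ?_)
    · have hd : d.1.2.2 ∉ Finset.univ.map d.1.1 := by simpa using d.2
      have h1 := hC (B Δ d) (hBm Δ d) (Finset.cons d.1.2.2 (Finset.univ.map d.1.1) hd) Δ hΔ0.le ?_
      · rwa [Finset.card_cons, Finset.card_map, Finset.card_univ, Fintype.card_fin] at h1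
      · intro j hj
        rcases Finset.mem_cons.1 hj with rfl | hj
        · simp only [B, Function.update_self, Real.volume_Ico, add_sub_cancel_left]
          exact ⟨fun t ht => abs_le_of_mem_Ico (hxR _) hΔ1 ht, le_rfl⟩
        · have hne : j ≠ d.1.2.2 := fun h => hd (h ▸ hj)
          simp only [B, Function.update_of_ne hne]
          exact cell_bounds hxR d.1.1 hΔ1 j hj
    · rw [Finset.card_univ, nsmul_eq_mul, mul_assoc]
  have hE : ∀ Δ : ℝ, (∀ i j, i ≠ j →
      Disjoint (Set.Ico (x i) (x i + Δ)) (Set.Ico (x j) (x j + Δ))) →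
      {y : Fin n → ℝ | ∀ i : Fin m, ∃ j : Fin n, y j ∈ Set.Ico (x i) (x i + Δ)} =
        ⋃ f : Fin m ↪ Fin n, Set.univ.pi (cell x f Δ) := by
    intro Δ hΔ
    ext y
    simp only [Set.mem_ofPred_eq, Set.mem_iUnion, Set.mem_univ_pi]
    constructor
    · intro h
      choose f hf using h
      refine ⟨⟨f, fun i j hij => ?_⟩, fun j i hi => hi ▸ hf i⟩
      by_contra hne
      exact Set.disjoint_left.1 (hΔ i j hne) (hf i) (hij ▸ hf j)
    · rintro ⟨f, hf⟩ i
      exact ⟨f i, hf (f i) i rfl⟩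
  have hdisj : ∀ Δ : ℝ, (∀ i j, i ≠ j →
      Disjoint (Set.Ico (x i) (x i + Δ)) (Set.Ico (x j) (x j + Δ))) →
      ∀ f g : Fin m ↪ Fin n, f ≠ g →
        Set.univ.pi (cell x f Δ) ∩ Set.univ.pi (cell x g Δ) ⊆ N Δ := by
    rintro Δ hΔ f g hfg y ⟨hf, hg⟩
    rw [Set.mem_univ_pi] at hf hg
    obtain ⟨i, hi⟩ : ∃ i, f i ≠ g i := by
      by_contra h
      push Not at h
      exact hfg (DFunLike.ext _ _ h)
    -- If `g i = f i'`, then `i' ≠ i`, and that particle would lie in two disjoint intervals.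
    have hgi : g i ∉ Set.range f := by
      rintro ⟨i', hi'⟩
      by_cases hii : i' = i
      · exact hi (hii ▸ hi')
      · exact Set.disjoint_left.1 (hΔ i' i hii) (hf (g i) i' hi') (hg (g i) i rfl)
    refine Set.mem_iUnion.2 ⟨⟨(f, i, g i), hgi⟩, Set.mem_univ_pi.2 fun j => ?_⟩
    by_cases hj : j = g i
    · subst hj
      simp only [B, Function.update_self]
      exact hg (g i) i rfl
    · simp only [B, Function.update_of_ne hj]
      exact hf j
  have hmain : Tendsto (fun Δ : ℝ => ∑ f : Fin m ↪ Fin n,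
      1 / Δ ^ m * (law n q).real (Set.univ.pi (cell x f Δ))) (𝓝[>] 0)
      (𝓝 (canonicalMean n q fun S => (projectionKernel x S).det)) := by
    have h := tendsto_finsetSum (Finset.univ : Finset (Fin m ↪ Fin n)) fun f _ =>
      tendsto_law_cell hq0 hq1 x f
    rwa [sum_embedding_const] at h
  have herr : Tendsto (fun Δ : ℝ => ∑ f : Fin m ↪ Fin n,
      1 / Δ ^ m * (law n q).real (Set.univ.pi (cell x f Δ)) -
        Fintype.card (Fin m ↪ Fin n) * (Fintype.card D * C) * Δ) (𝓝[>] 0)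
      (𝓝 (canonicalMean n q fun S => (projectionKernel x S).det)) := by
    have h0 : Tendsto (fun Δ : ℝ => Fintype.card (Fin m ↪ Fin n) * (Fintype.card D * C) * Δ)
        (𝓝[>] 0) (𝓝 (Fintype.card (Fin m ↪ Fin n) * (Fintype.card D * C) * 0)) :=
      (tendsto_nhdsWithin_of_tendsto_nhds tendsto_id).const_mul _
    simpa using hmain.sub h0
  have h1 : ∀ᶠ Δ : ℝ in 𝓝[>] 0, Δ ≤ 1 := nhdsWithin_le_nhds (Iic_mem_nhds zero_lt_one)
  refine tendsto_of_tendsto_of_tendsto_of_le_of_le' herr hmain ?_ ?_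
  · filter_upwards [self_mem_nhdsWithin, h1, eventually_disjoint_Ico hx] with Δ hΔ0 hΔ1 hΔd
    have hΔ0' : (0 : ℝ) < Δ := hΔ0
    have h2 := sum_measureReal_le_of_disjoint_sdiff (law n q)
      (fun f : Fin m ↪ Fin n => Set.univ.pi (cell x f Δ)) (N Δ)
      (fun f => MeasurableSet.univ_pi (measurableSet_cell x f Δ)) (hNm Δ) (hdisj Δ hΔd)
    rw [← hE Δ hΔd] at h2
    have h3 := mul_le_mul_of_nonneg_left (hN Δ hΔ0' hΔ1)
      (Nat.cast_nonneg (Fintype.card (Fin m ↪ Fin n)) : (0 : ℝ) ≤ _)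
    rw [← Finset.mul_sum, one_div, sub_le_iff_le_add, inv_mul_le_iff₀ (by positivity), mul_add,
      mul_inv_cancel_left₀ (by positivity)]
    rw [pow_succ] at h3
    linarith
  · filter_upwards [self_mem_nhdsWithin, eventually_disjoint_Ico hx] with Δ hΔ0 hΔd
    have hΔ0' : (0 : ℝ) < Δ := hΔ0
    rw [hE Δ hΔd, ← Finset.mul_sum]
    exact mul_le_mul_of_nonneg_left (measureReal_iUnion_fintype_le _) (by positivity)

end Limit

end MNS

end

theorem theorem1 (n : ℕ) (q : ℝ) (hq0 : 0 < q) (hq1 : q < 1) :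
    -- (a) the gap probability, with the objects in it well defined
    (∀ z : ℂ, (∀ k : ℕ, 1 + (q : ℂ) ^ k * z ≠ 0) →
      MNS.IsIntegralOperator (MNS.kernel q z) (MNS.opK q z)) ∧
    (∀ (A : Set ℝ) (hA : MeasurableSet A),
      (∀ z : ℂ, (∀ k : ℕ, 1 + (q : ℂ) ^ k * z ≠ 0) →
        MNS.HasFredholmDet (MNS.oneSubK q z Aᶜ hA.compl)
          (MNS.fredholmDet (MNS.oneSubK q z Aᶜ hA.compl))) ∧
      ∀ r : ℝ, 0 < r → (∀ k : ℕ, q ^ k * r ≠ 1) →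
        CircleIntegrable
          (fun z : ℂ => MNS.F n q z * MNS.fredholmDet (MNS.oneSubK q z Aᶜ hA.compl) / z) 0 r ∧
        (((MNS.law n q).real {x | ∀ i, x i ∈ A} : ℝ) : ℂ) =
          1 / (2 * (Real.pi : ℂ) * Complex.I) *
            ∮ z in C(0, r), MNS.F n q z * MNS.fredholmDet (MNS.oneSubK q z Aᶜ hA.compl) / z) ∧
    -- (b) the correlation functions
    (∀ (m : ℕ) (x : Fin m → ℝ) (r : ℝ), 0 < r → (∀ k : ℕ, q ^ k * r ≠ 1) →
      CircleIntegrable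
        (fun z : ℂ => MNS.F n q z *
          (Matrix.of fun i j : Fin m => MNS.kernel q z (x i) (x j)).det / z) 0 r ∧
      -- the correlation function as an integral of the density
      (m ≤ n → ((MNS.correlation n m q x : ℝ) : ℂ) =
        1 / (2 * (Real.pi : ℂ) * Complex.I) *
          ∮ z in C(0, r), MNS.F n q z *
            (Matrix.of fun i j : Fin m => MNS.kernel q z (x i) (x j)).det / z) ∧
      -- the correlation function as a limit of probabilities, at distinct points
      (Function.Injective x →
        Tendsto
          (fun Δ : ℝ =>
            ((1 / Δ ^ m * (MNS.law n q).real
              {y | ∀ i : Fin m, ∃ j : Fin n, y j ∈ Set.Ico (x i) (x i + Δ)} : ℝ) : ℂ))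
          (𝓝[>] 0)
          (𝓝 (1 / (2 * (Real.pi : ℂ) * Complex.I) *
            ∮ z in C(0, r), MNS.F n q z *
              (Matrix.of fun i j : Fin m => MNS.kernel q z (x i) (x j)).det / z)))) := by
  refine ⟨fun z _ => MNS.isIntegralOperator_opK hq0 hq1, fun A hA => ⟨fun z _ => ?_,
    fun r hr0 hr => ?_⟩, fun m x r hr0 hr => ?_⟩
  · rw [MNS.fredholmDet_oneSubK hq0 hq1]
    exact MNS.hasFredholmDet_oneSubK hq0 hq1 _ _
  · rw [MNS.law_real_forall_mem hq0 hq1 n hA]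
    exact MNS.gap_contour hq0 hq1 n hr0 hr hA
  · obtain ⟨hint, hI⟩ := MNS.kernel_contour hq0 hq1 n hr0 hr x
    refine ⟨hint, fun hmn => ?_, fun hx => ?_⟩
    · rw [MNS.correlation_eq hq0 hq1 hmn, hI]
    · rw [← hI]
      exact (Complex.continuous_ofReal.tendsto _).comp (MNS.tendsto_law_occupied hq0 hq1 n hx)
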